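/- Let $\mathbb{F}_q$ be the finite field with $q$ elements, let $C$ be a nonsingular projective (irreducible) curve over $\mathbb{F}_q$, let $\infty$ be a closed point of $C$, and let $A$ be the ring of functions on $C$ that are regular everywhere except possibly at $\infty$. Let $K$ be a field extension of $\mathbb{F}_q$ and let $i:A\to K$ be a morphism of $\mathbb{F}_q$-algebras. Let $K\{\tau\}$ be the ring of polynomials in $\tau$ with coefficients in $K$, where $\tau$ is the operator $x\mapsto x^q$, with the usual addition and with composition of operators as multiplication (so $\tau c=c^q\tau$ for $c\in K$). A \emph{Drinfeld module} is a ring homomorphism $\phi:A\to K\{\tau\}$, $a\mapsto\phi_a$, such that the coefficient of $\tau^0$ in $\phi_a$ is $i(a)$ for every $a\in A$, and $\phi_a\neq i(a)\tau^0$ for at least one $a\in A$. Let $\phi(K)$ denote the additive group of $K$ with the $A$-module structure $a\cdot x=\phi_a(x)$. For a nonzero $\gamma$ in an algebraic closure $K^{\mathrm{alg}}$ of $K$ let $\phi^{(\gamma)}:A\to K^{\mathrm{alg}}\{\tau\}$ be $a\mapsto\gamma^{-1}\phi_a\gamma$; its \emph{field of definition} is the smallest subfield of $K^{\mathrm{alg}}$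 containing all the coefficients of $\phi^{(\gamma)}_a$ for all $a\in A$. For a subfield $F$ of $K$, the \emph{relative modular transcendence degree} of $\phi$ over $F$ is the minimum, over all nonzero $\gamma\in K^{\mathrm{alg}}$, of the transcendence degree over $F$ of the compositum of $F$ and the field of definition of $\phi^{(\gamma)}$. Let $F$ be a countable subfield of $K$ such that $K$ is finitely generated as a field over $F$, and let $\phi:A\to K\{\tau\}$ be a Drinfeld module of positive relative modular transcendence degree over $F$. Then the $A$-module $\phi(K)$ is the direct sum of a finite torsion submodule and a free submodule of rank $\aleph_0$. -/

import Mathlib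

noncomputable section

/-! ### The coefficient ring `A` of functions on a curve regular away from `∞`

A nonsingular projective curve over the finite field `Fq` is given by its function field `E`, a
finitely generated extension of `Fq` of transcendence degree one.  Its closed points are the
nontrivial valuation rings of `E` (every valuation ring of `E` contains the finite field `Fq`),
the valuation ring of a closed point being the ring of functions regular at that point. -/

/-- `E` is the function field of a nonsingular projective curve over `Fq`. -/
def IsCurveFunctionField (Fq E : Type*) [Field Fq] [Field E] [Algebra Fq E] : Prop :=
  (⊤ : IntermediateField Fq E).FG ∧ Algebra.trdeg Fq E = 1

/-- An element of a finite field lies in every valuation subring of an extension field. -/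
theorem algebraMap_mem_valuationSubring (Fq : Type*) {E : Type*} [Field Fq] [Finite Fq] [Field E]
    [Algebra Fq E] (V : ValuationSubring E) (c : Fq) : algebraMap Fq E c ∈ V := by
  rcases eq_or_ne c 0 with rfl | hc
  · rw [map_zero]; exact V.zero_mem
  rcases V.mem_or_inv_mem (algebraMap Fq E c) with h | h
  · exact h
  have hfin : IsOfFinOrder (Units.mk0 c hc) := isOfFinOrder_of_finite _
  obtain ⟨n, hn, hn1⟩ := isOfFinOrder_iff_pow_eq_one.1 hfin
  have h1 : c ^ n = 1 := by simpa using congrArg Units.val hn1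
  have h2 : c = (c⁻¹) ^ (n - 1) := by
    obtain ⟨m, rfl⟩ : ∃ m, n = m + 1 := ⟨n - 1, by omega⟩
    rw [Nat.add_sub_cancel, inv_pow]
    exact eq_inv_of_mul_eq_one_right (by rw [← pow_succ]; exact h1)
  rw [h2, map_pow, map_inv₀]
  exact V.pow_mem h _

/-- The ring `A` of functions on the curve with function field `E` which are regular at every
closed point except possibly at the point `infty`. -/
def affineRing (Fq : Type*) {E : Type*} [Field Fq] [Finite Fq] [Field E] [Algebra Fq E]
    (infty : ValuationSubring E) : Subalgebra Fq E where
  carrier := {f | ∀ V : ValuationSubring E, V ≠ ⊤ → V ≠ infty → f ∈ V}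
  mul_mem' hf hg V h₁ h₂ := V.mul_mem _ _ (hf V h₁ h₂) (hg V h₁ h₂)
  add_mem' hf hg V h₁ h₂ := V.add_mem _ _ (hf V h₁ h₂) (hg V h₁ h₂)
  algebraMap_mem' c V _ _ := algebraMap_mem_valuationSubring Fq V c

/-! ### Twisted polynomials -/

/-- The operator `x ↦ x ^ q` on an extension field `K` of the field `Fq` with `q` elements. -/
def frobq (Fq K : Type*) [Field Fq] [Finite Fq] [Field K] [Algebra Fq K] : K →+* K :=
  letI : Fintype Fq := Fintype.ofFinite Fq
  (FiniteField.frobeniusAlgHom Fq K : K →+* K)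

theorem frobq_apply (Fq : Type*) {K : Type*} [Field Fq] [Finite Fq] [Field K] [Algebra Fq K]
    (x : K) : frobq Fq K x = x ^ Nat.card Fq := by
  let : Fintype Fq := Fintype.ofFinite Fq
  rw [Nat.card_eq_fintype_card]
  rfl

/-- The action of the powers of `τ` on `K` through `x ↦ x ^ q`. -/
@[reducible]
def frobqAction (Fq K : Type*) [Field Fq] [Finite Fq] [Field K] [Algebra Fq K] :
    MulSemiringAction (Multiplicative ℕ) K :=
  MulSemiringAction.compHom K (powersHom (K →+* K) (frobq Fq K))

/-- The ring `K{τ}` of polynomials in `τ` with coefficients in `K`, with the usual addition and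
with the multiplication determined by `τ c = c ^ q τ`. -/
def TwistedPoly (Fq K : Type*) [Field Fq] [Finite Fq] [Field K] [Algebra Fq K] : Type _ :=
  SkewPolynomial K

namespace TwistedPoly

variable (Fq : Type*) {K : Type*} [Field Fq] [Finite Fq] [Field K] [Algebra Fq K]

instance : Ring (TwistedPoly Fq K) :=
  letI := frobqAction Fq K
  inferInstanceAs (Ring (SkewPolynomial K))

variable {Fq} in
/-- The coefficient of `τ ^ n`. -/
def coeff (f : TwistedPoly Fq K) (n : ℕ) : K := SkewPolynomial.coeff f n

variable {Fq} in
/-- The set of exponents with nonzero coefficient. -/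
def support (f : TwistedPoly Fq K) : Finset ℕ := SkewPolynomial.support f

/-- The constant twisted polynomial `c τ⁰`. -/
def C : K →+* TwistedPoly Fq K :=
  letI := frobqAction Fq K
  SkewPolynomial.CRingHom

variable (K) in
/-- The twisted polynomial `τ`. -/
def tau : TwistedPoly Fq K := (SkewPolynomial.X : SkewPolynomial K)

theorem tau_mul_C (c : K) : tau Fq K * C Fq c = C Fq (c ^ Nat.card Fq) * tau Fq K := by
  let := frobqAction Fq K
  have h : (SkewPolynomial.X * SkewPolynomial.C c : SkewPolynomial K) =
      SkewPolynomial.C (c ^ Nat.card Fq) * SkewPolynomial.X := by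
    rw [← SkewPolynomial.monomial_zero_left, ← SkewPolynomial.monomial_zero_left,
      SkewPolynomial.X_mul_monomial, SkewPolynomial.monomial_mul_X, ← frobq_apply]
    rfl
  exact h

theorem tau_pow_mul_C (n : ℕ) (c : K) :
    tau Fq K ^ n * C Fq c = C Fq ((frobq Fq K ^ n) c) * tau Fq K ^ n := by
  induction n generalizing c with
  | zero => simp
  | succ n ih =>
    rw [pow_succ, mul_assoc, tau_mul_C, ← mul_assoc, ih, mul_assoc, ← frobq_apply]
    simp [pow_succ]

variable {Fq}

/-- The universal property of `K{τ}`: the ring homomorphism `∑ a_n τ ^ n ↦ ∑ f a_n * t ^ n`. -/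
def lift {R : Type*} [Ring R] (f : K →+* R) (t : R)
    (h : ∀ c, t * f c = f (c ^ Nat.card Fq) * t) : TwistedPoly Fq K →+* R :=
  letI := frobqAction Fq K
  SkewMonoidAlgebra.liftNCRingHom f (powersHom R t) (by
    intro c n
    change f ((frobq Fq K ^ n.toAdd) c) * t ^ n.toAdd = t ^ n.toAdd * f c
    generalize n.toAdd = m
    induction m generalizing c with
    | zero => simp
    | succ m ih =>
      rw [pow_succ t, mul_assoc (t ^ m), h, ← mul_assoc (t ^ m), ← ih, mul_assoc, ← frobq_apply]
      simp [pow_succ])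

theorem lift_apply {R : Type*} [Ring R] (f : K →+* R) (t : R)
    (h : ∀ c, t * f c = f (c ^ Nat.card Fq) * t) (g : TwistedPoly Fq K) :
    lift f t h g = ∑ n ∈ support g, f (coeff g n) * t ^ n := by
  exact SkewPolynomial.sum_def (R := K) g (fun n a => f a * t ^ n)

variable (Fq K) in
/-- The operator `x ↦ x ^ q` as an endomorphism of the additive group of `K`. -/
def frobEnd : AddMonoid.End K := (frobq Fq K).toAddMonoidHom

theorem frobEnd_pow_apply (n : ℕ) (x : K) : (frobEnd Fq K ^ n) x = x ^ (Nat.card Fq ^ n) := by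
  induction n with
  | zero => simp
  | succ n ih =>
    rw [pow_succ', AddMonoid.End.coe_mul, Function.comp_apply, ih]
    change frobq Fq K _ = _
    rw [frobq_apply, ← pow_mul, ← pow_succ]

/-- Twisted polynomials as additive operators on `K`: `∑ a_n τ ^ n` sends `x` to
`∑ a_n x ^ (q ^ n)`. -/
def evalHom : TwistedPoly Fq K →+* AddMonoid.End K :=
  lift (Module.toAddMonoidEnd K K) (frobEnd Fq K) (by
    intro c
    ext x
    change frobq Fq K (c * x) = c ^ Nat.card Fq * frobq Fq K x
    rw [map_mul, frobq_apply Fq c])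

theorem evalHom_apply (f : TwistedPoly Fq K) (x : K) :
    evalHom f x = ∑ n ∈ support f, coeff f n * x ^ (Nat.card Fq ^ n) := by
  rw [evalHom, lift_apply]
  refine (AddMonoidHom.finsetSum_apply (M := K) (N := K) _ _ _).trans ?_
  refine Finset.sum_congr rfl fun n _ => ?_
  change coeff f n * (frobEnd Fq K ^ n) x = _
  rw [frobEnd_pow_apply]

/-- The inclusion `K{τ} → L{τ}` for an extension `L` of `K`. -/
def baseChange (Fq K L : Type*) [Field Fq] [Finite Fq] [Field K] [Algebra Fq K] [Field L]
    [Algebra Fq L] [Algebra K L] : TwistedPoly Fq K →+* TwistedPoly Fq L :=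
  lift ((C Fq).comp (algebraMap K L)) (tau Fq L) (by
    intro c
    simp only [RingHom.comp_apply, tau_mul_C, map_pow])

/-- Conjugation `f ↦ γ⁻¹ f γ` by a nonzero element `γ` of `K`. -/
def conj (γ : Kˣ) : TwistedPoly Fq K →+* TwistedPoly Fq K where
  toFun f := C Fq ((γ⁻¹ : Kˣ) : K) * f * C Fq (γ : K)
  map_one' := by rw [mul_one, ← map_mul, Units.inv_mul, map_one]
  map_zero' := by rw [mul_zero, zero_mul]
  map_add' f g := by rw [mul_add, add_mul]
  map_mul' f g := by
    have h : C Fq (γ : K) * C Fq ((γ⁻¹ : Kˣ) : K) = 1 := by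
      rw [← map_mul, Units.mul_inv, map_one]
    calc C Fq ((γ⁻¹ : Kˣ) : K) * (f * g) * C Fq (γ : K)
        = C Fq ((γ⁻¹ : Kˣ) : K) * f * 1 * g * C Fq (γ : K) := by noncomm_ring
      _ = _ := by rw [← h]; noncomm_ring

end TwistedPoly

/-! ### Drinfeld modules -/

/-- A Drinfeld module over `K` with respect to `i : A → K`: a ring homomorphism
`φ : A → K{τ}` such that the constant coefficient of `φ_a` is `i a` for every `a`, and such that
`φ_a ≠ i(a) τ⁰` for at least one `a`. -/
structure DrinfeldModule {Fq A K : Type*} [Field Fq] [Finite Fq] [CommRing A] [Algebra Fq A]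
    [Field K] [Algebra Fq K] (i : A →ₐ[Fq] K) where
  /-- The homomorphism `a ↦ φ_a`. -/
  toRingHom : A →+* TwistedPoly Fq K
  coeff_zero : ∀ a, (toRingHom a).coeff 0 = i a
  nontrivial : ∃ a, toRingHom a ≠ TwistedPoly.C Fq (i a)

/-- The field of definition of a homomorphism `ψ : A → K{τ}`: the smallest subfield of `K`
containing all the coefficients of all the `ψ_a`. -/
def fieldOfDefinition {Fq A K : Type*} [Field Fq] [Finite Fq] [CommRing A] [Field K] [Algebra Fq K]
    (ψ : A →+* TwistedPoly Fq K) : Subfield K :=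
  Subfield.closure {c | ∃ a n, c = (ψ a).coeff n}

namespace DrinfeldModule

variable {Fq A K : Type*} [Field Fq] [Finite Fq] [CommRing A] [Algebra Fq A]
  [Field K] [Algebra Fq K] {i : A →ₐ[Fq] K}

/-- The conjugate `φ^(γ) : a ↦ γ⁻¹ φ_a γ` for a nonzero `γ` in the algebraic closure of `K`. -/
def conj (φ : DrinfeldModule i) (γ : (AlgebraicClosure K)ˣ) :
    A →+* TwistedPoly Fq (AlgebraicClosure K) :=
  ((TwistedPoly.conj γ).comp (TwistedPoly.baseChange Fq K (AlgebraicClosure K))).comp φ.toRingHom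

/-- The relative modular transcendence degree of `φ` over a subfield `F` of `K`: the minimum over
all nonzero `γ` in the algebraic closure of `K` of the transcendence degree over `F` of the
compositum of `F` and the field of definition of `φ^(γ)`. -/
def relModularTrdeg (F : Type*) [Field F] [Algebra F K] (φ : DrinfeldModule i) : Cardinal :=
  ⨅ γ : (AlgebraicClosure K)ˣ,
    Algebra.trdeg F (IntermediateField.adjoin F
      (fieldOfDefinition (φ.conj γ) : Set (AlgebraicClosure K)))

/-- `φ(K)`: the additive group of `K`, with `A` acting through `φ`. -/
@[nolint unusedArguments]
def Points (_ : DrinfeldModule i) : Type _ := K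

instance (φ : DrinfeldModule i) : AddCommGroup φ.Points := inferInstanceAs (AddCommGroup K)

/-- `a • x = φ_a(x)`. -/
instance (φ : DrinfeldModule i) : Module A φ.Points :=
  Module.compHom (R := AddMonoid.End K) K (TwistedPoly.evalHom.comp φ.toRingHom)

theorem smul_def (φ : DrinfeldModule i) (a : A) (x : K) :
    (show K from a • (show φ.Points from x)) = ∑ n ∈ (φ.toRingHom a).support,
      (φ.toRingHom a).coeff n * x ^ (Nat.card Fq ^ n) :=
  TwistedPoly.evalHom_apply (φ.toRingHom a) x

end DrinfeldModule

end

-- Choose `t` in `A` with `i t ≠ 0` and `φ_t` of degree at least 2 in `τ`. After conjugation by some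
-- `γ`, the operator `φ_t` is monic; it is separable, so it equals `x ↦ ∏ (x - l)` over a finite
-- group `Λ` with at least four elements. Every `φ_a` commutes with `φ_t`, so its conjugated
-- coefficients are algebraic over the field generated by `Λ`. Positive relative modular
-- transcendence degree therefore forces some `l` in `Λ` to be transcendental over `F`
-- (`exists_transcendental_of_relModularTrdeg_pos`). Enlarge `F` to an algebraically closed `F₁`
-- over which `K^alg` has transcendence degree one and `l` is still transcendental. The field `L`
-- generated over `F₁` by `Λ`, `γ` and `K` is a function field in one variable, and `l` has a pole
-- at some place (`exists_isEscapeSystem`).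
--
-- The arithmetic is that of escape to infinity. At each place, a point outside the smallest ball
-- containing `1` and `Λ` has its size raised to the power `|Λ|` by each application of `φ_t`. Only
-- finitely many `x` satisfy that `x` and `φ_t(x)` stay in this ball at every place
-- (`finite_setOf_le`): at a place where `Λ` has a pole, such an `x` is at distance less than 1 from
-- a point of `Λ`, and two such `x` with the same nearby points differ by an element which is
-- integral everywhere and vanishes somewhere, hence is 0. If `b x = ∑ e_j m_j` with each `deg e_j`
-- far below `deg b`, then `x` cannot escape; a pigeonhole on leading quotients extends finiteness
-- to all `deg e_j < deg b` (`finite_setOf_smul_eq_sum`). Division with remainder then shows that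
-- `φ(K)` is tame over `F_q[t]`: submodules of finite rank are finitely generated. The case without
-- `m_j` gives finite torsion, and powers of an element of `K` with a pole give infinite rank.
--
-- `A` has finite rank over `F_q[t]`, so tameness and infinite rank pass to `A`. Over a Dedekind
-- domain, a countable torsion-free tame module is a direct sum of finitely generated projective
-- modules; infinitely many nonzero summands make it free, by the Eilenberg swindle.

universe u

noncomputable section

/-! ### Projective modules of infinite rank -/

section Swindle

variable {A : Type*} [CommRing A]

/-- A linear map with a section splits its source. -/
def LinearMap.equivKerProd {M P : Type*} [AddCommGroup M] [Module A M] [AddCommGroup P] [Module A P]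
    (f : M →ₗ[A] P) (s : P →ₗ[A] M) (hs : ∀ x, f (s x) = x) : M ≃ₗ[A] LinearMap.ker f × P where
  toFun x := (⟨x - s (f x), by simp [hs]⟩, f x)
  map_add' x y := by ext <;> simp; abel
  map_smul' c x := by ext <;> simp [smul_sub]
  invFun p := p.1 + s p.2
  left_inv x := by simp
  right_inv p := by
    have h : f p.1 = 0 := p.1.2
    ext <;> simp [hs, h]

/-- A surjection onto a projective module splits. -/
theorem LinearMap.nonempty_equiv_ker_prod {M P : Type*} [AddCommGroup M] [Module A M]
    [AddCommGroup P] [Module A P] [Module.Projective A P] (f : M →ₗ[A] P)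
    (hf : Function.Surjective f) : Nonempty (M ≃ₗ[A] LinearMap.ker f × P) := by
  obtain ⟨s, hs⟩ := Module.projective_lifting_property f LinearMap.id hf
  exact ⟨f.equivKerProd s fun x => LinearMap.congr_fun hs x⟩

/-- Finitely supported functions into a product. -/
def finsuppProdEquiv (ι M P : Type*) [AddCommGroup M] [Module A M] [AddCommGroup P] [Module A P] :
    (ι →₀ M × P) ≃ₗ[A] (ι →₀ M) × (ι →₀ P) :=
  LinearEquiv.ofLinearMap
    ((Finsupp.mapRange.linearMap (LinearMap.fst A M P)).prod
      (Finsupp.mapRange.linearMap (LinearMap.snd A M P)))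
    ((Finsupp.mapRange.linearMap (LinearMap.inl A M P)).coprod
      (Finsupp.mapRange.linearMap (LinearMap.inr A M P)))
    (by ext <;> simp) (by ext <;> simp)

/-- Splitting off the first term of a finitely supported sequence. -/
def finsuppNatEquiv (M : Type*) [AddCommGroup M] [Module A M] : (ℕ →₀ M) ≃ₗ[A] M × (ℕ →₀ M) :=
  Finsupp.domLCongr Equiv.natSumPUnitEquivNat.{0}.symm ≪≫ₗ Finsupp.sumFinsuppLEquivProdFinsupp A ≪≫ₗ
    LinearEquiv.prodCongr (LinearEquiv.refl A _) (Finsupp.uniqueLinearEquiv A M PUnit.unit) ≪≫ₗ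
    LinearEquiv.prodComm A _ _

/-- A countable projective module which maps onto a free module of infinite rank is free. -/
theorem Module.Projective.nonempty_equiv_finsupp_of_surjective {N : Type*} [AddCommGroup N]
    [Module A N] [Module.Projective A N] [Countable N] (f : N →ₗ[A] ℕ →₀ A)
    (hf : Function.Surjective f) : Nonempty (N ≃ₗ[A] ℕ →₀ A) := by
  obtain ⟨e₁⟩ := f.nonempty_equiv_ker_prod hf
  set Q := LinearMap.ker f
  have : Module.Projective A Q :=
    Module.Projective.of_split (e₁.symm.toLinearMap ∘ₗ LinearMap.inl A Q _)
      (LinearMap.fst A Q _ ∘ₗ e₁.toLinearMap) (by ext; simp)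
  obtain ⟨c, hc⟩ := exists_surjective_nat Q
  obtain ⟨e₂⟩ := (Finsupp.linearCombination A c).nonempty_equiv_ker_prod fun x => by
    obtain ⟨n, rfl⟩ := hc x
    exact ⟨Finsupp.single n 1, by simp⟩
  set Q' := LinearMap.ker (Finsupp.linearCombination A c)
  -- Eilenberg swindle: a free module of infinite rank is a countable sum of copies of itself, so it
  -- contains infinitely many copies of `Q` as a direct factor and absorbs one more.
  have e₃ : (ℕ →₀ A) ≃ₗ[A] (ℕ →₀ Q') × (ℕ →₀ Q) :=
    (Finsupp.domLCongr (Denumerable.eqv (ℕ × ℕ)).symm) ≪≫ₗ Finsupp.curryLinearEquiv A ≪≫ₗ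
      Finsupp.mapRange.linearEquiv e₂ ≪≫ₗ finsuppProdEquiv ℕ Q' Q
  exact ⟨e₁ ≪≫ₗ LinearEquiv.prodCongr (LinearEquiv.refl A Q) e₃ ≪≫ₗ
    LinearEquiv.prodCongr (LinearEquiv.refl A Q) (LinearEquiv.prodComm A _ _) ≪≫ₗ
    (LinearEquiv.prodAssoc A Q _ _).symm ≪≫ₗ
    LinearEquiv.prodCongr (finsuppNatEquiv Q).symm (LinearEquiv.refl A _) ≪≫ₗ
    LinearEquiv.prodComm A _ _ ≪≫ₗ e₃.symm⟩

end Swindle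

/-! ### Projective modules and coprime ideals over a Dedekind domain -/

section Dedekind

variable {A : Type*} [CommRing A] [IsDedekindDomain A]

/-- Over a Dedekind domain, a finitely generated torsion-free module is projective. -/
theorem IsDedekindDomain.projective_of_isTorsionFree (Q : Type*) [AddCommGroup Q] [Module A Q]
    [Module.IsTorsionFree A Q] [Module.Finite A Q] : Module.Projective A Q := by
  have := Module.finitePresentation_of_finite A Q
  -- Torsion-free modules over a Dedekind domain are flat.
  exact Module.Flat.projective_of_finitePresentation

/-- Every nonzero ideal of a Dedekind domain can be moved inside its class so that it becomes
coprime to a given nonzero ideal. -/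
theorem Ideal.exists_linearMap_range_sup_eq_top (I J : Ideal A) (hI : I ≠ ⊥) (hJ : J ≠ ⊥) :
    ∃ g : J →ₗ[A] A, I ⊔ LinearMap.range g = ⊤ := by
  -- With `J H = (c)` and `I H + (a) = H`, the map is `x ↦ a x / c`. Multiplying `I H + (a) = H` by
  -- `J` gives `I (c) + a J = (c)`, which becomes the claim after division by `c`.
  obtain ⟨c, hcJ, hc⟩ := Submodule.exists_mem_ne_zero_of_ne_bot hJ
  obtain ⟨H, hH⟩ : J ∣ Ideal.span {c} :=
    Ideal.dvd_iff_le.2 (J.span_singleton_le_iff_mem.2 hcJ)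
  have hH0 : H ≠ ⊥ := by
    rintro rfl
    exact hc (by simpa using hH)
  obtain ⟨a, ha⟩ := IsDedekindDomain.exists_sup_span_eq (Ideal.mul_le_right : I * H ≤ H)
    (mul_ne_zero hI hH0)
  have haH : a ∈ H := ha ▸ Ideal.mem_sup_right (Ideal.mem_span_singleton_self a)
  have hdiv (x : J) : a * x ∈ Ideal.span {c} := by
    rw [hH, mul_comm J H]; exact Ideal.mul_mem_mul haH x.2
  let m : J →ₗ[A] Ideal.span {c} :=
    LinearMap.codRestrict _ (LinearMap.lsmul A A a ∘ₗ J.subtype) hdiv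
  let e := LinearEquiv.toSpanNonzeroSingleton A A c hc
  have key (x : J) : e.symm (m x) * c = a * x := by
    have h : ((e (e.symm (m x)) : Ideal.span {c}) : A) = a * x := by
      rw [e.apply_symm_apply]; rfl
    rwa [LinearEquiv.toSpanNonzeroSingleton_apply] at h
  refine ⟨e.symm.toLinearMap ∘ₗ m, (Ideal.eq_top_iff_one _).2 ?_⟩
  have h1 : c ∈ I * Ideal.span {c} ⊔ Ideal.span {a} * J := by
    have : I * Ideal.span {c} ⊔ Ideal.span {a} * J = Ideal.span {c} := by
      rw [hH, mul_comm J H, ← mul_assoc, ← Ideal.sup_mul, ha]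
    rw [this]; exact Ideal.mem_span_singleton_self c
  obtain ⟨y, hy, z, hz, hyz⟩ := Submodule.mem_sup.1 h1
  obtain ⟨i, hi, rfl⟩ := Ideal.mem_mul_span_singleton.1 hy
  obtain ⟨x, hx, rfl⟩ := Ideal.mem_span_singleton_mul.1 hz
  have h2 : i + e.symm (m ⟨x, hx⟩) = 1 :=
    mul_right_cancel₀ hc (by rw [add_mul, key, one_mul]; exact hyz)
  rw [← h2]
  exact Submodule.add_mem_sup hi ⟨⟨x, hx⟩, rfl⟩

/-- A single projective module need not map onto `A`, but two nonzero ones together do; this is what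
lets the summands be grouped in pairs. -/
theorem exists_linearMap_range_sup_eq_top {Q₁ Q₂ : Type*} [AddCommGroup Q₁] [Module A Q₁]
    [AddCommGroup Q₂] [Module A Q₂] (f₁ : Q₁ →ₗ[A] A) (f₂ : Q₂ →ₗ[A] A) (h₁ : f₁ ≠ 0)
    (h₂ : f₂ ≠ 0) : ∃ g : Q₂ →ₗ[A] A, LinearMap.range f₁ ⊔ LinearMap.range g = ⊤ := by
  obtain ⟨g, hg⟩ := Ideal.exists_linearMap_range_sup_eq_top (LinearMap.range f₁)
    (LinearMap.range f₂) (by rwa [Ne, LinearMap.range_eq_bot])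
    (by rwa [Ne, LinearMap.range_eq_bot])
  refine ⟨g ∘ₗ f₂.rangeRestrict, ?_⟩
  rwa [LinearMap.range_comp_of_range_eq_top _ f₂.range_rangeRestrict]

end Dedekind

/-! ### Isolated closures -/

section Isolated

theorem Submodule.exists_fg_map_eq {A V W : Type*} [CommRing A] [AddCommGroup V] [Module A V] 
    [AddCommGroup W] [Module A W] (f : V →ₗ[A] W)
    (hf : Function.Surjective f) {N : Submodule A W} (hN : N.FG) :
    ∃ N' : Submodule A V, N'.FG ∧ N'.map f = N := by
  classical
  obtain ⟨s, rfl⟩ := hN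
  choose g hg using hf
  refine ⟨Submodule.span A (s.image g), ⟨_, rfl⟩, ?_⟩
  rw [Submodule.map_span, Finset.coe_image, ← Set.image_comp]
  congr 1
  simp [hg]

variable {A V : Type*} [CommRing A] [IsDomain A] [AddCommGroup V] [Module A V]

/-- The elements which have a nonzero multiple in `N`. -/
def Submodule.isolated (N : Submodule A V) : Submodule A V :=
  (Submodule.torsion A (V ⧸ N)).comap N.mkQ

theorem Submodule.mem_isolated {N : Submodule A V} {x : V} :
    x ∈ N.isolated ↔ ∃ a : A, a ≠ 0 ∧ a • x ∈ N := by
  rw [isolated, mem_comap, mem_torsion_iff]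
  constructor
  · rintro ⟨a, ha⟩
    exact ⟨a, nonZeroDivisors.coe_ne_zero a, (Submodule.Quotient.mk_eq_zero N).1 ha⟩
  · rintro ⟨a, ha, hx⟩
    exact ⟨⟨a, mem_nonZeroDivisors_of_ne_zero ha⟩, (Submodule.Quotient.mk_eq_zero N).2 hx⟩

theorem Submodule.le_isolated (N : Submodule A V) : N ≤ N.isolated := fun x hx =>
  mem_isolated.2 ⟨1, one_ne_zero, by rwa [one_smul]⟩

theorem Submodule.isolated_mono {N N' : Submodule A V} (h : N ≤ N') : N.isolated ≤ N'.isolated :=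
  fun _ hx => by
    obtain ⟨a, ha, h'⟩ := mem_isolated.1 hx
    exact mem_isolated.2 ⟨a, ha, h h'⟩

theorem Submodule.isolated_isolated (N : Submodule A V) : N.isolated.isolated = N.isolated := by
  refine le_antisymm (fun x hx => ?_) (le_isolated _)
  obtain ⟨a, ha, h⟩ := mem_isolated.1 hx
  obtain ⟨b, hb, h⟩ := mem_isolated.1 h
  exact mem_isolated.2 ⟨b * a, mul_ne_zero hb ha, by rwa [mul_smul]⟩

theorem Submodule.isolated_bot : (⊥ : Submodule A V).isolated = Submodule.torsion A V := by
  ext x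
  rw [mem_isolated, mem_torsion_iff]
  constructor
  · rintro ⟨a, ha, h⟩
    exact ⟨⟨a, mem_nonZeroDivisors_of_ne_zero ha⟩, h⟩
  · rintro ⟨a, h⟩
    exact ⟨a, nonZeroDivisors.coe_ne_zero a, h⟩

theorem Submodule.isTorsionFree_quotient {N : Submodule A V} (h : N.isolated = N) :
    Module.IsTorsionFree A (V ⧸ N) := by
  rw [Submodule.isTorsionFree_iff_torsion_eq_bot, eq_bot_iff]
  intro y hy
  obtain ⟨x, rfl⟩ := N.mkQ_surjective y
  exact (Submodule.Quotient.mk_eq_zero N).2 (h.le hy)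

variable (A V) in
/-- Every submodule of finite rank is finitely generated. -/
def Module.IsTame : Prop := ∀ N : Submodule A V, N.FG → N.isolated.FG

variable (A V) in
/-- The isolated closure of a finitely generated submodule is never everything. -/
def Module.IsInfiniteRank : Prop := ∀ N : Submodule A V, N.FG → N.isolated ≠ ⊤

/-- The isolated closure is compatible with dividing out the torsion. -/
theorem Submodule.isolated_map_mkQ_torsion (N : Submodule A V) :
    (N.map (Submodule.torsion A V).mkQ).isolated = N.isolated.map (Submodule.torsion A V).mkQ := by
  ext y
  obtain ⟨x, rfl⟩ := (Submodule.torsion A V).mkQ_surjective y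
  constructor
  · intro h
    obtain ⟨a, ha, n, hn, h⟩ := mem_isolated.1 h
    rw [← map_smul, ← sub_eq_zero, ← map_sub] at h
    have h' : n - a • x ∈ Submodule.torsion A V := (Submodule.Quotient.mk_eq_zero _).1 h
    rw [← isolated_bot, mem_isolated] at h'
    obtain ⟨b, hb, h'⟩ := h'
    rw [mem_bot, smul_sub, sub_eq_zero] at h'
    exact ⟨x, mem_isolated.2 ⟨b * a, mul_ne_zero hb ha, by
      rw [mul_smul, ← h']; exact N.smul_mem b hn⟩, rfl⟩
  · rintro ⟨z, hz, h⟩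
    obtain ⟨a, ha, h'⟩ := mem_isolated.1 hz
    rw [← h]
    exact mem_isolated.2 ⟨a, ha, a • z, h', map_smul _ _ _⟩

theorem Module.IsTame.quotient_torsion (h : Module.IsTame A V) :
    Module.IsTame A (V ⧸ Submodule.torsion A V) := by
  intro N hN
  obtain ⟨N, hN', rfl⟩ := Submodule.exists_fg_map_eq _ (Submodule.mkQ_surjective _) hN
  rw [Submodule.isolated_map_mkQ_torsion]
  exact (h N hN').map _

theorem Module.IsInfiniteRank.quotient_torsion (h : Module.IsInfiniteRank A V) :
    Module.IsInfiniteRank A (V ⧸ Submodule.torsion A V) := by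
  intro N hN htop
  obtain ⟨N, hN', rfl⟩ := Submodule.exists_fg_map_eq _ (Submodule.mkQ_surjective _) hN
  rw [Submodule.isolated_map_mkQ_torsion] at htop
  refine h N hN' (eq_top_iff.2 fun x _ => ?_)
  have hx : (Submodule.torsion A V).mkQ x ∈ N.isolated.map (Submodule.torsion A V).mkQ :=
    htop ▸ Submodule.mem_top
  obtain ⟨z, hz, hzx⟩ := hx
  have h1 : x - z ∈ Submodule.torsion A V :=
    (Submodule.Quotient.mk_eq_zero _).1 (by rw [Submodule.Quotient.mk_sub, sub_eq_zero]; exact hzx.symm)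
  rw [← Submodule.isolated_bot] at h1
  have h2 := N.isolated.add_mem (Submodule.isolated_mono bot_le h1) hz
  rwa [sub_add_cancel] at h2

end Isolated

/-! ### Countable tame modules over a Dedekind domain -/

section Chain

variable {A V : Type*} [CommRing A] [IsDedekindDomain A] [AddCommGroup V] [Module A V]

/-- A module with an exhausting chain of submodules `N n` and sections `s n` of
`N (n + 1) → N (n + 1) ⧸ N n` is the direct sum of the successive quotients. -/
theorem nonempty_directSum_equiv_of_chain {A V : Type*} [CommRing A] [AddCommGroup V] [Module A V]
    (N : ℕ → Submodule A V) (hmono : Monotone N) (h0 : N 0 = ⊥) (htop : ∀ x, ∃ n, x ∈ N n)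
    (Q : ℕ → Type*) [∀ n, AddCommGroup (Q n)] [∀ n, Module A (Q n)] (s : ∀ n, Q n →ₗ[A] V)
    (hs : ∀ n q, s n q ∈ N (n + 1)) (hinj : ∀ n q, s n q ∈ N n → q = 0)
    (hsurj : ∀ n, ∀ x ∈ N (n + 1), ∃ q, x - s n q ∈ N n) :
    Nonempty (DirectSum ℕ Q ≃ₗ[A] V) := by
  classical
  let Φ := DirectSum.toModule A ℕ V s
  refine ⟨LinearEquiv.ofBijective Φ ⟨?_, ?_⟩⟩
  · rw [injective_iff_map_eq_zero]
    intro d hd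
    by_contra hne
    have hsupp : d.support.Nonempty := by
      rw [Finset.nonempty_iff_ne_empty]
      exact fun h => hne (DFinsupp.support_eq_empty.1 h)
    -- At the largest index `n` of the support, all the other terms of the vanishing sum lie in `N
    -- n`, so `hinj` kills the component at `n`.
    set n := d.support.max' hsupp
    have hn : n ∈ d.support := d.support.max'_mem hsupp
    have hsum : Φ d = ∑ j ∈ d.support, s j (d j) := by
      conv_lhs => rw [← DirectSum.sum_support_of d]
      rw [map_sum]
      exact Finset.sum_congr rfl fun j _ => DirectSum.toModule_lof A (φ := s) j (d j)
    rw [← Finset.add_sum_erase _ _ hn, hd] at hsum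
    have hrest : ∑ j ∈ d.support.erase n, s j (d j) ∈ N n := by
      refine Submodule.sum_mem _ fun j hj => ?_
      have hjn : j < n := lt_of_le_of_ne (d.support.le_max' j (Finset.mem_of_mem_erase hj))
        (Finset.ne_of_mem_erase hj)
      exact hmono (Nat.succ_le_of_lt hjn) (hs j _)
    refine DFinsupp.mem_support_iff.1 hn (hinj n _ ?_)
    rw [eq_neg_of_add_eq_zero_left hsum.symm]
    exact neg_mem hrest
  · rw [← LinearMap.range_eq_top, eq_top_iff]
    have key : ∀ n, N n ≤ LinearMap.range Φ := by
      intro n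
      induction n with
      | zero => rw [h0]; exact bot_le
      | succ n ih =>
        intro x hx
        obtain ⟨q, hq⟩ := hsurj n x hx
        have h2 : s n q ∈ LinearMap.range Φ := ⟨DirectSum.lof A ℕ _ n q,
          DirectSum.toModule_lof A n q⟩
        simpa using add_mem (ih hq) h2
    intro x _
    obtain ⟨n, hn⟩ := htop x
    exact key n hn

/-- A countable direct sum of nonzero finitely generated torsion-free modules over a Dedekind
domain maps onto a free module of infinite rank. -/
theorem exists_surjective_directSum_finsupp (Q : ℕ → Type*) [∀ n, AddCommGroup (Q n)]
    [∀ n, Module A (Q n)] [∀ n, Module.Projective A (Q n)] [∀ n, Nontrivial (Q n)] :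
    ∃ f : DirectSum ℕ Q →ₗ[A] (ℕ →₀ A), Function.Surjective f := by
  have hex (n : ℕ) : ∃ f : Q n →ₗ[A] A, f ≠ 0 := by
    obtain ⟨x, hx⟩ := exists_ne (0 : Q n)
    obtain ⟨f, hf⟩ := Module.Projective.exists_dual_ne_zero A hx
    exact ⟨f, fun h => hf (by rw [h]; rfl)⟩
  choose f₀ hf₀ using hex
  choose g hg using fun n => exists_linearMap_range_sup_eq_top (f₀ (n - 1)) (f₀ n) (hf₀ _) (hf₀ _)
  -- The summands `2m` and `2m + 1` together map onto the `m`-th copy of `A`. Only odd indices use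
  -- `g`, so the truncated `0 - 1` in its choice is harmless.
  let f (n : ℕ) : Q n →ₗ[A] A := if n % 2 = 1 then g n else f₀ n
  let Φ : DirectSum ℕ Q →ₗ[A] (ℕ →₀ A) :=
    DirectSum.toModule A ℕ _ fun n => Finsupp.lsingle (n / 2) ∘ₗ f n
  refine ⟨Φ, ?_⟩
  have hmem (n : ℕ) (q : Q n) : Finsupp.single (n / 2) (f n q) ∈ LinearMap.range Φ :=
    ⟨DirectSum.lof A ℕ _ n q, DirectSum.toModule_lof A n q⟩
  rw [← LinearMap.range_eq_top, eq_top_iff]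
  intro x _
  induction x using Finsupp.induction_linear with
  | zero => exact zero_mem _
  | add x y hx hy => exact add_mem (hx trivial) (hy trivial)
  | single m a =>
    have ha : a ∈ LinearMap.range (f₀ (2 * m + 1 - 1)) ⊔ LinearMap.range (g (2 * m + 1)) := by
      rw [hg]; trivial
    obtain ⟨_, ⟨u, rfl⟩, _, ⟨v, rfl⟩, rfl⟩ := Submodule.mem_sup.1 ha
    rw [Finsupp.single_add]
    have h1 := hmem (2 * m + 1 - 1) u
    have h2 := hmem (2 * m + 1) v
    rw [show f (2 * m + 1 - 1) = f₀ _ from if_neg (by omega),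
      show (2 * m + 1 - 1) / 2 = m by omega] at h1
    rw [show f (2 * m + 1) = g _ from if_pos (by omega), show (2 * m + 1) / 2 = m by omega] at h2
    exact add_mem h1 h2

/-- A countable torsion-free tame module of infinite rank over a Dedekind domain is free. -/
theorem Module.IsTame.nonempty_equiv_finsupp [Countable V] [Module.IsTorsionFree A V]
    (ht : Module.IsTame A V) (hinf : Module.IsInfiniteRank A V) :
    Nonempty (V ≃ₗ[A] ℕ →₀ A) := by
  obtain ⟨e, he⟩ := exists_surjective_nat V
  have hbot : (⊥ : Submodule A V).isolated = ⊥ := by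
    rw [Submodule.isolated_bot]; exact Submodule.isTorsionFree_iff_torsion_eq_bot.1 inferInstance
  -- Each step adjoins `e n`, so that the chain exhausts `V`, and an element outside of `P`, so that
  -- the successive quotients are nonzero. Tameness keeps the isolated closure finitely generated.
  have hstep (n : ℕ) (P : {P : Submodule A V // P.FG ∧ P.isolated = P}) :
      ∃ P' : {P : Submodule A V // P.FG ∧ P.isolated = P}, P.1 < P'.1 ∧ e n ∈ P'.1 := by
    have h1 : P.1 ≠ ⊤ := P.2.2 ▸ hinf P.1 P.2.1
    obtain ⟨y, -, hy⟩ := SetLike.exists_of_lt (lt_top_iff_ne_top.2 h1)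
    have hfg : (P.1 ⊔ Submodule.span A {e n, y}).FG :=
      P.2.1.sup (Submodule.fg_span (Set.toFinite _))
    have hsub : Submodule.span A {e n, y} ≤ (P.1 ⊔ Submodule.span A {e n, y}).isolated :=
      le_sup_right.trans (Submodule.le_isolated _)
    refine ⟨⟨_, ht _ hfg, Submodule.isolated_isolated _⟩, lt_of_le_of_ne
      (le_sup_left.trans (Submodule.le_isolated _)) fun h => hy ?_,
      hsub (Submodule.subset_span (by simp))⟩
    rw [h]
    exact hsub (Submodule.subset_span (by simp))
  choose F hF using hstep
  let S : ℕ → {P : Submodule A V // P.FG ∧ P.isolated = P} :=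
    fun n => Nat.rec ⟨⊥, Submodule.fg_bot, hbot⟩ F n
  let N : ℕ → Submodule A V := fun n => (S n).1
  have hlt (n : ℕ) : N n < N (n + 1) := (hF n (S n)).1
  have hmem (n : ℕ) : e n ∈ N (n + 1) := (hF n (S n)).2
  have htf (n : ℕ) : Module.IsTorsionFree A (V ⧸ N n) :=
    Submodule.isTorsionFree_quotient (S n).2.2
  let Q (n : ℕ) := (N (n + 1)).map (N n).mkQ
  have hfin (n : ℕ) : Module.Finite A (Q n) :=
    Module.Finite.iff_fg.2 ((S (n + 1)).2.1.map _)
  have hproj (n : ℕ) : Module.Projective A (Q n) :=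
    have : Module.IsTorsionFree A (Q n) :=
      (Q n).injective_subtype.moduleIsTorsionFree _ fun _ _ => rfl
    IsDedekindDomain.projective_of_isTorsionFree _
  have hnt (n : ℕ) : Nontrivial (Q n) := by
    obtain ⟨x, hx, hx'⟩ := SetLike.exists_of_lt (hlt n)
    refine ⟨⟨(N n).mkQ x, x, hx, rfl⟩, 0, fun h => hx' ?_⟩
    exact (Submodule.Quotient.mk_eq_zero _).1 (congrArg Subtype.val h)
  have hsec (n : ℕ) : ∃ s : Q n →ₗ[A] V, (∀ q, s q ∈ N (n + 1)) ∧ ∀ q, (N n).mkQ (s q) = q := by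
    let r : N (n + 1) →ₗ[A] Q n :=
      LinearMap.codRestrict _ ((N n).mkQ ∘ₗ (N (n + 1)).subtype) fun x => ⟨x, x.2, rfl⟩
    obtain ⟨s, hs⟩ := Module.projective_lifting_property r LinearMap.id (by
      rintro ⟨_, x, hx, rfl⟩
      exact ⟨⟨x, hx⟩, rfl⟩)
    exact ⟨(N (n + 1)).subtype ∘ₗ s, fun q => (s q).2,
      fun q => congrArg Subtype.val (LinearMap.congr_fun hs q)⟩
  choose s hs hsq using hsec
  obtain ⟨E⟩ := nonempty_directSum_equiv_of_chain N (monotone_nat_of_le_succ fun n => (hlt n).le)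
    rfl (fun x => by
      obtain ⟨n, rfl⟩ := he x
      exact ⟨n + 1, hmem n⟩) (fun n => Q n) s hs
    (fun n q hq => Subtype.ext ((hsq n q).symm.trans ((Submodule.Quotient.mk_eq_zero _).2 hq)))
    (fun n x hx => ⟨⟨(N n).mkQ x, x, hx, rfl⟩, by
      rw [← Submodule.Quotient.mk_eq_zero, Submodule.Quotient.mk_sub, sub_eq_zero]
      exact (hsq n ⟨(N n).mkQ x, x, hx, rfl⟩).symm⟩)
  obtain ⟨f, hf⟩ := exists_surjective_directSum_finsupp (A := A) fun n => Q n
  have : Module.Projective A V := Module.Projective.of_equiv E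
  exact Module.Projective.nonempty_equiv_finsupp_of_surjective (f ∘ₗ E.symm.toLinearMap)
    (hf.comp E.symm.surjective)

/-- A countable tame module of infinite rank over a Dedekind domain is the direct sum of its
torsion submodule and of a free module of rank `ℵ₀`. -/
theorem Module.IsTame.exists_isCompl_torsion [Countable V] (ht : Module.IsTame A V)
    (hinf : Module.IsInfiniteRank A V) :
    ∃ N : Submodule A V, IsCompl (Submodule.torsion A V) N ∧ Nonempty (N ≃ₗ[A] ℕ →₀ A) := by
  set T := Submodule.torsion A V
  have : Countable (V ⧸ T) := T.mkQ_surjective.countable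
  obtain ⟨e⟩ := ht.quotient_torsion.nonempty_equiv_finsupp hinf.quotient_torsion
  have : Module.Projective A (V ⧸ T) := Module.Projective.of_equiv e.symm
  obtain ⟨s, hs⟩ := Module.projective_lifting_property T.mkQ LinearMap.id T.mkQ_surjective
  have hs' (x) : T.mkQ (s x) = x := LinearMap.congr_fun hs x
  refine ⟨LinearMap.range s, ?_,
    ⟨(LinearEquiv.ofInjective s (Function.LeftInverse.injective hs')).symm ≪≫ₗ e⟩⟩
  rw [isCompl_iff, Submodule.disjoint_def, codisjoint_iff, eq_top_iff]
  constructor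
  · rintro _ hx ⟨y, rfl⟩
    have : y = 0 := by rw [← hs' y]; exact (Submodule.Quotient.mk_eq_zero T).2 hx
    rw [this, map_zero]
  · intro x _
    have h1 : x - s (T.mkQ x) ∈ T := by
      rw [← Submodule.Quotient.mk_eq_zero, Submodule.Quotient.mk_sub, sub_eq_zero]
      exact (hs' _).symm
    simpa using Submodule.add_mem_sup h1 (LinearMap.mem_range_self s (T.mkQ x))

end Chain

/-! ### Valuations and additive polynomials -/

section Escape

open Polynomial WithZero

variable {L ι : Type*} [Field L]

/-- A family of discrete valuations of a field satisfying the finiteness property and the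
consequence of the product formula that an element which is integral everywhere is a unit
everywhere, together with a finite group of at least three elements not all of which are
integral. -/
structure IsEscapeSystem (v : ι → Valuation L ℤᵐ⁰) (Λ : Finset L) : Prop where
  zero_mem : (0 : L) ∈ Λ
  add_mem : ∀ l ∈ Λ, ∀ m ∈ Λ, l + m ∈ Λ
  three_le_card : 3 ≤ Λ.card
  finite_ne_one : ∀ x : L, x ≠ 0 → {i | v i x ≠ 1}.Finite
  eq_one_of_le_one : ∀ x : L, x ≠ 0 → (∀ i, v i x ≤ 1) → ∀ i, v i x = 1
  exists_one_lt : ∃ i, ∃ l ∈ Λ, 1 < v i l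

/-- The radius of the smallest closed ball around `0` which contains `1` and the given finite
set. -/
def escapeRadius (w : Valuation L ℤᵐ⁰) (Λ : Finset L) : ℤᵐ⁰ := max 1 (Λ.sup w)

section Local

variable (w : Valuation L ℤᵐ⁰) (Λ : Finset L)

theorem one_le_escapeRadius : 1 ≤ escapeRadius w Λ := le_max_left _ _

variable {Λ} in
theorem le_escapeRadius {l : L} (hl : l ∈ Λ) : w l ≤ escapeRadius w Λ :=
  (Finset.le_sup (f := w) hl).trans (le_max_right _ _)

theorem exists_eq_escapeRadius (h : escapeRadius w Λ ≠ 1) : ∃ l ∈ Λ, w l = escapeRadius w Λ := by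
  have hne : Λ.Nonempty := by
    rw [Finset.nonempty_iff_ne_empty]
    rintro rfl
    exact h (by simp [escapeRadius])
  obtain ⟨l, hl, h'⟩ := Finset.exists_mem_eq_sup Λ hne w
  refine ⟨l, hl, ?_⟩
  rcases max_choice 1 (Λ.sup w) with h1 | h1
  · exact absurd h1 h
  · rw [escapeRadius, h1, h']

variable {w Λ}

theorem Valuation.map_prod_sub_eq {x : L} (hx : escapeRadius w Λ < w x) :
    w (∏ l ∈ Λ, (x - l)) = w x ^ Λ.card := by
  rw [map_prod, Finset.prod_congr rfl fun l hl => ?_, Finset.prod_const]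
  exact Valuation.map_sub_eq_of_lt_left w ((le_escapeRadius w hl).trans_lt hx)

theorem Valuation.map_prod_sub_le {x : L} {c : ℤᵐ⁰} (hc : escapeRadius w Λ ≤ c) (hx : w x ≤ c) :
    w (∏ l ∈ Λ, (x - l)) ≤ c ^ Λ.card := by
  rw [map_prod, ← Finset.prod_const]
  exact Finset.prod_le_prod' fun l hl =>
    (w.map_sub x l).trans (max_le hx ((le_escapeRadius w hl).trans hc))

/-- If the product of the distances of `x` to the points of a finite group containing
nonintegral elements is not large, then one of these distances is less than one. -/
theorem exists_map_sub_lt_one (h0 : (0 : L) ∈ Λ) (hadd : ∀ l ∈ Λ, ∀ m ∈ Λ, l + m ∈ Λ)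
    (hcard : 3 ≤ Λ.card) (hR : escapeRadius w Λ ≠ 1) {x : L}
    (hx : w (∏ l ∈ Λ, (x - l)) ≤ escapeRadius w Λ) : ∃ l ∈ Λ, w (x - l) < 1 := by
  classical
  obtain ⟨l, hl, hmin⟩ := Λ.exists_min_image (fun l => w (x - l)) ⟨0, h0⟩
  refine ⟨l, hl, ?_⟩
  by_contra! h1
  -- Since `l` is a nearest point, every translate `l + d` is at distance at least `w d` from `x`.
  have hdist (d : L) (hd : d ∈ Λ) : w d ≤ w (x - (l + d)) := by
    have : d = (x - l) - (x - (l + d)) := by ring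
    conv_lhs => rw [this]
    exact (w.map_sub _ _).trans (max_le (hmin _ (hadd l hl d hd)) le_rfl)
  obtain ⟨d, hd, hdR⟩ := exists_eq_escapeRadius w Λ hR
  have hR1 : 1 < escapeRadius w Λ := lt_of_le_of_ne (one_le_escapeRadius w Λ) (Ne.symm hR)
  -- Three elements in the group yield two of maximal size: if `m`, different from `0` and `d`, is
  -- small, then `d + m` is as large as `d`. The product is then at least the square of the radius,
  -- which exceeds the radius.
  obtain ⟨e, he, hed, heR⟩ : ∃ e ∈ Λ, e ≠ d ∧ escapeRadius w Λ ≤ w e := by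
    obtain ⟨m, hm, hm'⟩ := Finset.exists_mem_notMem_of_card_lt_card
      (s := {0, d}) (t := Λ) ((Finset.card_le_two).trans_lt (by omega))
    rw [Finset.mem_insert, Finset.mem_singleton, not_or] at hm'
    rcases le_or_gt (escapeRadius w Λ) (w m) with h | h
    · exact ⟨m, hm, hm'.2, h⟩
    · refine ⟨d + m, hadd d hd m hm, by simpa using hm'.1, ?_⟩
      rw [Valuation.map_add_eq_of_lt_left w (h.trans_eq hdR.symm), hdR]
  have hsub : ({l + d, l + e} : Finset L) ⊆ Λ := by
    intro y hy
    rw [Finset.mem_insert, Finset.mem_singleton] at hy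
    rcases hy with rfl | rfl
    exacts [hadd l hl d hd, hadd l hl e he]
  have h2 : escapeRadius w Λ * escapeRadius w Λ ≤ ∏ m ∈ ({l + d, l + e} : Finset L), w (x - m) := by
    rw [Finset.prod_pair (by simpa using hed.symm)]
    exact mul_le_mul' (hdR.ge.trans (hdist d hd)) (heR.trans (hdist e he))
  have h3 : ∏ m ∈ ({l + d, l + e} : Finset L), w (x - m) ≤ ∏ m ∈ Λ, w (x - m) :=
    Finset.prod_le_prod_of_subset_of_one_le' hsub fun m hm _ => h1.trans (hmin m hm)
  rw [map_prod] at hx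
  have h4 := (h2.trans h3).trans hx
  have h5 : escapeRadius w Λ * 1 < escapeRadius w Λ * escapeRadius w Λ :=
    mul_lt_mul_of_pos_left hR1 (zero_lt_one.trans hR1)
  rw [mul_one] at h5
  exact absurd h4 (not_le.2 h5)

end Local

namespace IsEscapeSystem

variable {v : ι → Valuation L ℤᵐ⁰} {Λ : Finset L}

theorem finite_escapeRadius_ne_one (h : IsEscapeSystem v Λ) :
    {i | escapeRadius (v i) Λ ≠ 1}.Finite := by
  classical
  refine ((Λ.erase 0).finite_toSet.biUnion fun l hl => h.finite_ne_one l
    (Finset.ne_of_mem_erase hl)).subset fun i hi => ?_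
  obtain ⟨l, hl, hl'⟩ := exists_eq_escapeRadius (v i) Λ hi
  refine Set.mem_biUnion (x := l) (Finset.mem_coe.2 (Finset.mem_erase.2 ⟨?_, hl⟩)) (by
    rw [Set.mem_ofPred_eq, hl']; exact hi)
  rintro rfl
  have := one_le_escapeRadius (v i) Λ
  rw [← hl', map_zero] at this
  exact absurd this (by simp)

/-- The elements whose first iterates stay in the smallest ball are finite in number. -/
theorem finite_setOf_le (h : IsEscapeSystem v Λ) :
    {x : L | ∀ i, v i x ≤ escapeRadius (v i) Λ ∧
      v i (∏ l ∈ Λ, (x - l)) ≤ escapeRadius (v i) Λ}.Finite := by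
  set W := {x : L | ∀ i, v i x ≤ escapeRadius (v i) Λ ∧
      v i (∏ l ∈ Λ, (x - l)) ≤ escapeRadius (v i) Λ}
  set B := {i | escapeRadius (v i) Λ ≠ 1}
  have hB : Finite B := h.finite_escapeRadius_ne_one
  have hex (x : W) (i : B) : ∃ l : Λ, v i (x - l) < 1 := by
    obtain ⟨l, hl, h'⟩ := exists_map_sub_lt_one h.zero_mem h.add_mem h.three_le_card i.2
      (x.2 i).2
    exact ⟨⟨l, hl⟩, h'⟩
  -- An element of `W` is determined by its nearby points of `Λ` at the finitely many bad places,
  -- that is, by an element of the finite set `B → Λ`.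
  choose f hf using hex
  have : Function.Injective f := by
    intro x y hxy
    by_contra hne
    have hz : (x - y : L) ≠ 0 := sub_ne_zero.2 fun h => hne (Subtype.ext h)
    have hlt (i : B) : v i (x - y : L) < 1 := by
      have h1 := hf y i
      rw [← hxy] at h1
      rw [← sub_sub_sub_cancel_right (x : L) y (f x i)]
      exact ((v i).map_sub _ _).trans_lt (max_lt (hf x i) h1)
    have hle (i : ι) : v i (x - y : L) ≤ 1 := by
      by_cases hi : escapeRadius (v i) Λ = 1
      · exact ((v i).map_sub _ _).trans (max_le (hi ▸ (x.2 i).1) (hi ▸ (y.2 i).1))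
      · exact (hlt ⟨i, hi⟩).le
    obtain ⟨i, l, hl, hi⟩ := h.exists_one_lt
    exact (hlt ⟨i, (hi.trans_le (le_escapeRadius _ hl)).ne'⟩).ne (h.eq_one_of_le_one _ hz hle i)
  exact Finite.of_injective f this

variable {k M : Type*} [Field k] [AddCommGroup M] [Module k[X] M] {ψ : M →+ L}

/-- Elements in a ball grow at most like the degree of the polynomial acting on them. -/
theorem map_smul_le {w : Valuation L ℤᵐ⁰} (hX : ∀ x : M, ψ ((X : k[X]) • x) = ∏ l ∈ Λ, (ψ x - l))
    (hC : ∀ (c : k) (x : M), w (ψ (C c • x)) ≤ w (ψ x)) (hΛ : Λ.card ≠ 0) (d : ℕ) :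
    ∀ (e : k[X]), e.natDegree ≤ d → ∀ (m : M) (c : ℤᵐ⁰), escapeRadius w Λ ≤ c → w (ψ m) ≤ c →
      w (ψ (e • m)) ≤ c ^ Λ.card ^ d := by
  induction d with
  | zero =>
    intro e he m c hc hm
    rw [eq_C_of_natDegree_le_zero he, pow_zero, pow_one]
    exact (hC _ _).trans hm
  | succ d ih =>
    intro e he m c hc hm
    have hc1 : 1 ≤ c := (one_le_escapeRadius w Λ).trans hc
    have h1 : c ≤ c ^ Λ.card := le_self_pow hc1 hΛ
    -- Horner's scheme: one application of `X` replaces the bound `c` by `c ^ Λ.card` and lowers the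
    -- degree by one.
    rw [← divX_mul_X_add e, add_smul, mul_smul, map_add]
    refine (w.map_add _ _).trans (max_le ?_ ?_)
    · rw [pow_succ', pow_mul]
      refine ih _ ?_ _ _ (hc.trans h1) ?_
      · rw [natDegree_divX_eq_natDegree_tsub_one]; omega
      · rw [hX]
        exact Valuation.map_prod_sub_le hc hm
    · exact ((hC _ _).trans hm).trans (le_self_pow hc1 (pow_ne_zero _ hΛ))

/-- Outside of the escape radius the growth is exactly given by the degree. -/
theorem map_smul_eq {w : Valuation L ℤᵐ⁰} (hX : ∀ x : M, ψ ((X : k[X]) • x) = ∏ l ∈ Λ, (ψ x - l))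
    (hC : ∀ (c : k), c ≠ 0 → ∀ x : M, w (ψ (C c • x)) = w (ψ x)) (hΛ : 1 < Λ.card) (d : ℕ) :
    ∀ (b : k[X]), b ≠ 0 → b.natDegree = d → ∀ (y : M), escapeRadius w Λ < w (ψ y) →
      w (ψ (b • y)) = w (ψ y) ^ Λ.card ^ d := by
  induction d with
  | zero =>
    intro b hb hd y hy
    rw [eq_C_of_natDegree_eq_zero hd, pow_zero, pow_one]
    refine hC _ (fun h => hb ?_) y
    rw [eq_C_of_natDegree_eq_zero hd, h, C_0]
  | succ d ih =>
    intro b hb hd y hy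
    have hy1 : 1 < w (ψ y) := (one_le_escapeRadius w Λ).trans_lt hy
    have hXy : w (ψ ((X : k[X]) • y)) = w (ψ y) ^ Λ.card := by
      rw [hX, Valuation.map_prod_sub_eq hy]
    have hdX : b.divX.natDegree = d := by
      rw [natDegree_divX_eq_natDegree_tsub_one]; omega
    have hne : b.divX ≠ 0 := by
      intro h0
      rw [divX_eq_zero_iff] at h0
      rw [h0, natDegree_C] at hd
      omega
    have h1 : w (ψ (b.divX • (X : k[X]) • y)) = w (ψ y) ^ Λ.card ^ (d + 1) := by
      rw [ih _ hne hdX _ (by rw [hXy]; exact hy.trans_le (le_self_pow hy1.le (by omega))), hXy,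
        ← pow_mul, ← pow_succ']
    -- The constant term contributes at most `w (ψ y)`, strictly less than the rest, so the
    -- ultrametric inequality is an equality.
    rw [← divX_mul_X_add b, add_smul, mul_smul, map_add, Valuation.map_add_eq_of_lt_left w, h1]
    rw [h1]
    refine lt_of_le_of_lt ?_ (lt_self_pow₀ hy1 (Nat.one_lt_pow (by omega) hΛ))
    by_cases hc : b.coeff 0 = 0
    · simp [hc]
    · exact (hC _ hc y).le

end IsEscapeSystem

end Escape

/-! ### Tameness and linear independence from escape -/

section EscapeModule

open Polynomial WithZero

namespace IsEscapeSystem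

variable {L ι k M : Type*} [Field L] {v : ι → Valuation L ℤᵐ⁰} {Λ : Finset L}
  [Field k] [AddCommGroup M] [Module k[X] M] {ψ : M →+ L}

/-- An element with a multiple by `b` which is a combination of fixed elements with coefficients
of much smaller degree than `b` does not leave the smallest balls. -/
theorem exists_forall_mem_ball (h : IsEscapeSystem v Λ)
    (hX : ∀ x : M, ψ ((X : k[X]) • x) = ∏ l ∈ Λ, (ψ x - l))
    (hC : ∀ i, ∀ c : k, c ≠ 0 → ∀ x : M, v i (ψ (C c • x)) = v i (ψ x))
    {s : ℕ} (m : Fin s → M) :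
    ∃ N : ℕ, ∀ (b : k[X]) (e : Fin s → k[X]) (x : M), b ≠ 0 → b • x = ∑ j, e j • m j →
      (∀ j, (e j * X ^ N).degree < b.degree) → ∀ i, ∀ n ≤ 1,
        v i (ψ ((X : k[X]) ^ n • x)) ≤ escapeRadius (v i) Λ := by
  classical
  set Q := Λ.card
  have hQ : 3 ≤ Q := h.three_le_card
  let c (i : ι) : ℤᵐ⁰ := max (escapeRadius (v i) Λ) (Finset.univ.sup fun j => v i (ψ (m j)))
  have hcR (i) : escapeRadius (v i) Λ ≤ c i := le_max_left _ _
  have hcm (i j) : v i (ψ (m j)) ≤ c i :=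
    (Finset.le_sup (f := fun j => v i (ψ (m j))) (Finset.mem_univ j)).trans (le_max_right _ _)
  have hfin : {i | c i ≠ 1}.Finite := by
    refine (h.finite_escapeRadius_ne_one.union (Set.finite_iUnion fun j : {j // ψ (m j) ≠ 0} =>
      h.finite_ne_one _ j.2)).subset fun i hi => ?_
    by_contra hi'
    simp only [Set.mem_union, Set.mem_ofPred_eq, Set.mem_iUnion, not_or, not_not, not_exists] at hi'
    refine hi (le_antisymm (max_le hi'.1.le (Finset.sup_le fun j _ => ?_))
      ((one_le_escapeRadius _ _).trans (hcR i)))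
    by_cases hj : ψ (m j) = 0
    · simp [hj]
    · exact (hi'.2 ⟨j, hj⟩).le
  -- A uniform `N` exists because `c i = 1` at all but finitely many places.
  obtain ⟨N, hN⟩ : ∃ N : ℕ, ∀ i, log (c i) < N := by
    refine ⟨hfin.toFinset.sup (fun i => (log (c i)).toNat) + 1, fun i => ?_⟩
    by_cases hi : c i = 1
    · rw [hi, log_one]; positivity
    · have := Finset.le_sup (f := fun i => (log (c i)).toNat) (hfin.mem_toFinset.2 hi)
      push_cast
      omega
  refine ⟨N, fun b e x hb hbx hdeg i n hn => ?_⟩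
  by_contra! hy
  set y := (X : k[X]) ^ n • x
  have hy1 : 1 < v i (ψ y) := (one_le_escapeRadius _ _).trans_lt hy
  have hup := map_smul_eq hX (hC i) (by omega) _ b hb rfl y hy
  have hby : b • y = ∑ j, (X ^ n * e j) • m j := by
    rw [smul_comm, hbx, Finset.smul_sum]
    simp only [mul_smul]
  have hnat (j) (hj : e j ≠ 0) : (e j).natDegree + N < b.natDegree := by
    have := natDegree_lt_natDegree (mul_ne_zero hj (pow_ne_zero N X_ne_zero)) (hdeg j)
    rwa [natDegree_mul hj (pow_ne_zero N X_ne_zero), natDegree_X_pow] at this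
  by_cases h0 : ∀ j, e j = 0
  · rw [hby, Finset.sum_eq_zero fun j _ => by rw [h0 j, mul_zero, zero_smul], map_zero, map_zero]
      at hup
    exact pow_ne_zero _ (zero_lt_one.trans hy1).ne' hup.symm
  push Not at h0
  obtain ⟨j₀, hj₀⟩ := h0
  -- `D` bounds the degree of each `X ^ n * e j`: the strict inequality in `hnat` leaves room for
  -- the extra `n ≤ 1`.
  obtain ⟨D, hD⟩ : ∃ D, b.natDegree = N + D := ⟨b.natDegree - N, by have := hnat j₀ hj₀; omega⟩
  have hle : v i (ψ (b • y)) ≤ c i ^ Q ^ D := by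
    rw [hby, map_sum]
    refine Valuation.map_sum_le _ fun j _ => map_smul_le hX (fun a z => ?_) (by omega) D _ ?_ _ _
      (hcR i) (hcm i j)
    · by_cases ha : a = 0
      · simp [ha]
      · exact (hC i a ha z).le
    · by_cases hj : e j = 0
      · simp [hj]
      · rw [natDegree_mul (pow_ne_zero n X_ne_zero) hj, natDegree_X_pow]
        have := hnat j hj
        omega
  rw [hup, hD, pow_add, pow_mul] at hle
  -- Cancelling the exponent `Q ^ D` leaves `v i (ψ y) ^ Q ^ N ≤ c i`. As `log (v i (ψ y)) ≥ 1`,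
  -- this gives `Q ^ N ≤ log (c i) < N`, which is absurd.
  have hle' := (pow_le_pow_iff_left₀ zero_le zero_le (pow_ne_zero D (by omega : Q ≠ 0))).1 hle
  have hc0 : c i ≠ 0 :=
    (zero_lt_one.trans_le ((one_le_escapeRadius (v i) Λ).trans (hcR i))).ne'
  have hv0 : v i (ψ y) ≠ 0 := (zero_lt_one.trans hy1).ne'
  rw [← log_le_log (pow_ne_zero _ hv0) hc0, log_pow] at hle'
  have hlog : 1 ≤ log (v i (ψ y)) := by
    have := (log_lt_log one_ne_zero hv0).2 hy1
    rw [log_one] at this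
    omega
  have hQN : (N : ℤ) < ((Q ^ N : ℕ) : ℤ) := by
    exact_mod_cast Nat.lt_pow_self (by omega : 1 < Q)
  have := hN i
  rw [nsmul_eq_mul] at hle'
  nlinarith

/-- The elements with a multiple by `b` which is a combination of fixed elements with coefficients
of smaller degree than `b` are finite in number. -/
theorem finite_setOf_smul_eq_sum [Finite k] (h : IsEscapeSystem v Λ) (hψ : Function.Injective ψ)
    (hX : ∀ x : M, ψ ((X : k[X]) • x) = ∏ l ∈ Λ, (ψ x - l))
    (hC : ∀ i, ∀ c : k, c ≠ 0 → ∀ x : M, v i (ψ (C c • x)) = v i (ψ x))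
    {s : ℕ} (m : Fin s → M) :
    {x : M | ∃ (b : k[X]) (e : Fin s → k[X]), b ≠ 0 ∧ b • x = ∑ j, e j • m j ∧
      ∀ j, (e j).degree < b.degree}.Finite := by
  obtain ⟨N, hN⟩ := h.exists_forall_mem_ball hX hC m
  have hW : {x : M | ∀ i, ∀ n ≤ 1,
      v i (ψ ((X : k[X]) ^ n • x)) ≤ escapeRadius (v i) Λ}.Finite := by
    refine (h.finite_setOf_le.preimage hψ.injOn).subset fun x hx i => ⟨?_, ?_⟩
    · simpa using hx i 0 zero_le_one
    · rw [← hX]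
      simpa using hx i 1 le_rfl
  set S := {x : M | ∃ (b : k[X]) (e : Fin s → k[X]), b ≠ 0 ∧ b • x = ∑ j, e j • m j ∧
      ∀ j, (e j).degree < b.degree}
  have hdata (x : M) : ∃ (b : k[X]) (e : Fin s → k[X]), x ∈ S → b ≠ 0 ∧ b • x = ∑ j, e j • m j ∧
      ∀ j, (e j).degree < b.degree := by
    by_cases hx : x ∈ S
    · obtain ⟨b, e, h'⟩ := hx
      exact ⟨b, e, fun _ => h'⟩
    · exact ⟨0, 0, fun h => absurd h hx⟩
  choose b e hbe using hdata
  -- Pigeonhole on the first `N` digits of the fractions `e j / b` expanded in powers of `1 / X`.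
  -- These polynomials have degree less than `N` over a finite field, so there are finitely many
  -- values.
  let f (x : M) (j : Fin s) : k[X] := (e x j * X ^ N) / b x
  refine Set.Finite.of_finite_fibers f ?_ ?_
  · have hT : (Set.univ.pi fun _ : Fin s => (degreeLT k N : Set k[X])).Finite := by
      refine Set.Finite.pi fun _ => ?_
      have : Finite (degreeLT k N) := Finite.of_equiv _ (degreeLTEquiv k N).symm.toEquiv
      exact Set.toFinite _
    refine hT.subset ?_
    rintro _ ⟨x, hx, rfl⟩ j -
    obtain ⟨hb, -, hdeg⟩ := hbe x hx
    rw [SetLike.mem_coe, mem_degreeLT]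
    rcases lt_or_ge (e x j * X ^ N).degree (b x).degree with hlt | hle
    · change ((e x j * X ^ N) / b x).degree < _
      rw [(Polynomial.div_eq_zero_iff hb).2 hlt, degree_zero]
      exact WithBot.bot_lt_coe N
    · have h1 := degree_add_div hb hle
      rw [degree_mul, degree_X_pow] at h1
      by_contra! h2
      have h3 : (e x j).degree + N < (b x).degree + N := by
        exact WithBot.add_lt_add_right (WithBot.coe_ne_bot) (hdeg j)
      rw [← h1] at h3
      exact absurd h3 (not_lt.2 (by gcongr))
  · rintro _ ⟨y, hy, rfl⟩
    refine ((hW.image fun w => w + y)).subset fun x hx => ⟨x - y, ?_, sub_add_cancel _ _⟩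
    obtain ⟨hx, hxy⟩ := hx
    obtain ⟨hbx, hx1, hx2⟩ := hbe x hx
    obtain ⟨hby, hy1, hy2⟩ := hbe y hy
    -- When the quotients agree, they cancel in the numerators of the differences of fractions, and
    -- only remainders are left. Hence `x - y` satisfies the strong degree inequality and does not
    -- escape.
    refine hN (b x * b y) (fun j => b y * e x j - b x * e y j) (x - y) (mul_ne_zero hbx hby) ?_ ?_
    · rw [smul_sub, mul_comm (b x), mul_smul, hx1, mul_comm (b y), mul_smul, hy1,
        Finset.smul_sum, Finset.smul_sum, ← Finset.sum_sub_distrib]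
      simp only [sub_smul, mul_smul]
    · intro j
      have hxj := EuclideanDomain.div_add_mod (e x j * X ^ N) (b x)
      have hyj := EuclideanDomain.div_add_mod (e y j * X ^ N) (b y)
      have hf : e x j * X ^ N / b x = e y j * X ^ N / b y := congrFun hxy j
      have : (b y * e x j - b x * e y j) * X ^ N =
          b y * (e x j * X ^ N % b x) - b x * (e y j * X ^ N % b y) := by
        rw [hf] at hxj
        linear_combination b x * hyj - b y * hxj
      rw [this]
      refine (degree_sub_le _ _).trans_lt (max_lt ?_ ?_)
      · rw [mul_comm (b x), degree_mul, degree_mul]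
        exact WithBot.add_lt_add_left (degree_ne_bot.2 hby) (degree_mod_lt _ hbx)
      · rw [degree_mul, degree_mul]
        exact WithBot.add_lt_add_left (degree_ne_bot.2 hbx) (degree_mod_lt _ hby)

/-- Only finitely many elements are annihilated by a nonzero polynomial. -/
theorem finite_torsion [Finite k] (h : IsEscapeSystem v Λ) (hψ : Function.Injective ψ)
    (hX : ∀ x : M, ψ ((X : k[X]) • x) = ∏ l ∈ Λ, (ψ x - l))
    (hC : ∀ i, ∀ c : k, c ≠ 0 → ∀ x : M, v i (ψ (C c • x)) = v i (ψ x)) :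
    {x : M | ∃ b : k[X], b ≠ 0 ∧ b • x = 0}.Finite :=
  (h.finite_setOf_smul_eq_sum hψ hX hC (Fin.elim0 : Fin 0 → M)).subset
    fun _ ⟨b, hb, hx⟩ => ⟨b, Fin.elim0, hb, by simpa using hx, fun j => j.elim0⟩

/-- If `b • x` is a combination of generators, subtracting the quotients of the coefficients by `b`
leaves remainders of smaller degree. So the isolated closure is spanned by the generators and a
finite set. -/
theorem isTame [Finite k] (h : IsEscapeSystem v Λ) (hψ : Function.Injective ψ)
    (hX : ∀ x : M, ψ ((X : k[X]) • x) = ∏ l ∈ Λ, (ψ x - l))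
    (hC : ∀ i, ∀ c : k, c ≠ 0 → ∀ x : M, v i (ψ (C c • x)) = v i (ψ x)) :
    Module.IsTame k[X] M := by
  intro N hN
  obtain ⟨s, m, rfl⟩ := Submodule.fg_iff_exists_fin_generating_family.1 hN
  set S := {x : M | ∃ (b : k[X]) (e : Fin s → k[X]), b ≠ 0 ∧ b • x = ∑ j, e j • m j ∧
      ∀ j, (e j).degree < b.degree}
  have hS : S.Finite := h.finite_setOf_smul_eq_sum hψ hX hC m
  have : (Submodule.span k[X] (Set.range m)).isolated = Submodule.span k[X] (S ∪ Set.range m) := by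
    refine le_antisymm (fun x hx => ?_) (Submodule.span_le.2 (Set.union_subset ?_ ?_))
    · obtain ⟨b, hb, hbx⟩ := Submodule.mem_isolated.1 hx
      obtain ⟨c, hc⟩ := (Submodule.mem_span_range_iff_exists_fun _).1 hbx
      have h1 : x - ∑ j, (c j / b) • m j ∈ S := by
        refine ⟨b, fun j => c j % b, hb, ?_, fun j => degree_mod_lt _ hb⟩
        rw [smul_sub, ← hc, Finset.smul_sum, ← Finset.sum_sub_distrib]
        refine Finset.sum_congr rfl fun j _ => ?_
        rw [smul_smul, ← sub_smul, ← EuclideanDomain.mod_eq_sub_mul_div]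
      rw [← sub_add_cancel x (∑ j, (c j / b) • m j)]
      exact AddMemClass.add_mem (Submodule.subset_span (Or.inl h1)) (Submodule.sum_mem _ fun j _ =>
        Submodule.smul_mem _ _ (Submodule.subset_span (Or.inr ⟨j, rfl⟩)))
    · rintro x ⟨b, e, hb, hbx, -⟩
      refine Submodule.mem_isolated.2 ⟨b, hb, ?_⟩
      rw [hbx]
      exact Submodule.sum_mem _ fun j _ => Submodule.smul_mem _ _ (Submodule.subset_span ⟨j, rfl⟩)
    · exact fun x hx => Submodule.le_isolated _ (Submodule.subset_span hx)
  rw [this]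
  exact Submodule.fg_span (hS.union (Set.finite_range m))

/-- Elements of distinct large sizes within a factor of two of each other, on a logarithmic scale,
are linearly independent. -/
theorem linearIndependent_of_log {w : Valuation L ℤᵐ⁰}
    (hX : ∀ x : M, ψ ((X : k[X]) • x) = ∏ l ∈ Λ, (ψ x - l))
    (hC : ∀ c : k, c ≠ 0 → ∀ x : M, w (ψ (C c • x)) = w (ψ x)) (hΛ : 1 < Λ.card)
    {s : ℕ} (x : Fin s → M) (hx : ∀ j, escapeRadius w Λ < w (ψ (x j)))
    (hinj : Function.Injective fun j => log (w (ψ (x j))))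
    (h2 : ∀ i j, log (w (ψ (x i))) < 2 * log (w (ψ (x j)))) :
    LinearIndependent k[X] x := by
  classical
  rw [Fintype.linearIndependent_iff]
  intro b hb
  by_contra! hne
  set J := Finset.univ.filter fun j => b j ≠ 0
  have hJ : J.Nonempty := hne.imp fun j hj => by simp [J, hj]
  have hval (j) (hj : j ∈ J) : w (ψ (b j • x j)) = w (ψ (x j)) ^ Λ.card ^ (b j).natDegree :=
    map_smul_eq hX hC hΛ _ _ (Finset.mem_filter.1 hj).2 rfl _ (hx j)
  have hpos (j) : w (ψ (x j)) ≠ 0 :=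
    ((zero_lt_one.trans_le (one_le_escapeRadius w Λ)).trans (hx j)).ne'
  have hdist (i) (hi : i ∈ J) (j) (hj : j ∈ J) (hij : w (ψ (b i • x i)) = w (ψ (b j • x j))) :
      i = j := by
    rw [hval i hi, hval j hj] at hij
    have key (i j : Fin s) (d d' : ℕ) (hdd : d ≤ d')
        (hij : w (ψ (x i)) ^ Λ.card ^ d = w (ψ (x j)) ^ Λ.card ^ d') : i = j := by
      -- Equal sizes give `log (w (ψ (x i))) = Λ.card ^ t * log (w (ψ (x j)))`. For `t = 0` the
      -- logarithms agree, and for `t > 0` the ratio is at least two, contrary to `h2`. So the terms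
      -- of a relation have distinct sizes and cannot cancel.
      obtain ⟨t, rfl⟩ := Nat.exists_eq_add_of_le hdd
      rw [pow_add, mul_comm, pow_mul] at hij
      have h3 := (pow_left_inj₀ zero_le zero_le
        (pow_ne_zero d (by omega : Λ.card ≠ 0))).1 hij
      have h4 := congrArg log h3
      rw [log_pow] at h4
      rcases Nat.eq_zero_or_pos t with rfl | ht
      · exact hinj (by simpa using h4)
      · exfalso
        have h5 := h2 i j
        have h6 : 2 ≤ Λ.card ^ t := le_trans (by omega) (Nat.le_self_pow ht.ne' Λ.card)
        have h7 : 0 < log (w (ψ (x j))) := by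
          have := (log_lt_log one_ne_zero (hpos j)).2 ((one_le_escapeRadius w Λ).trans_lt (hx j))
          rwa [log_one] at this
        rw [nsmul_eq_mul] at h4
        have h8 : (2 : ℤ) ≤ (Λ.card ^ t : ℕ) := by exact_mod_cast h6
        nlinarith
    rcases le_total (b i).natDegree (b j).natDegree with hd | hd
    · exact key i j _ _ hd hij
    · exact (key j i _ _ hd hij.symm).symm
  obtain ⟨j, hj, hmax⟩ := J.exists_max_image (fun j => w (ψ (b j • x j))) hJ
  have hsum : ∑ i ∈ J, ψ (b i • x i) = 0 := by
    rw [← map_sum, Finset.sum_filter_of_ne, hb, map_zero]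
    intro i _ hi h0
    exact hi (by rw [h0, zero_smul])
  have h9 : w (∑ i ∈ J, ψ (b i • x i)) = w (ψ (b j • x j)) :=
    Valuation.map_sum_eq_of_lt w hj fun i hi => by
      have hi' := Finset.mem_sdiff.1 hi
      refine lt_of_le_of_ne (hmax i hi'.1) fun h => hi'.2 ?_
      rw [Finset.mem_singleton]
      exact hdist i hi'.1 j hj h
  rw [hsum, map_zero, hval j hj] at h9
  exact pow_ne_zero _ (hpos j) h9.symm

end IsEscapeSystem

end EscapeModule

/-! ### Function fields in one variable -/

section FunctionField

open Polynomial WithZero IntermediateField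

/-- An element which lies in all the valuation subrings containing the image of `R` is integral
over `R`. -/
theorem isIntegral_of_forall_mem_valuationSubring {R L : Type*} [CommRing R] [Field L]
    [Algebra R L] {x : L}
    (h : ∀ V : ValuationSubring L, (∀ r, algebraMap R L r ∈ V) → x ∈ V) : IsIntegral R x := by
  have h1 : x ∈ (integralClosure (Subring.closure (Set.range (algebraMap R L))) L).toSubring := by
    rw [← iInf_valuationSubring_superset, Subring.mem_iInf]
    exact fun V => h V.1 fun r => V.2 ⟨r, rfl⟩
  have h2 : Subring.closure (Set.range (algebraMap R L)) = (algebraMap R L).range :=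
    (congrArg _ (RingHom.coe_range _).symm).trans (Subring.closure_eq _)
  rw [h2] at h1
  replace h1 : IsIntegral (algebraMap R L).range x := h1
  let : Algebra R (algebraMap R L).range := (algebraMap R L).rangeRestrict.toAlgebra
  have : IsScalarTower R (algebraMap R L).range L := IsScalarTower.of_algebraMap_eq fun _ => rfl
  have : Algebra.IsIntegral R (algebraMap R L).range :=
    Algebra.isIntegral_of_surjective (algebraMap R L).rangeRestrict_surjective
  exact isIntegral_trans x h1

/-- A valuation subring containing the image of `R` contains the elements integral over `R`. -/
theorem IsIntegral.mem_valuationSubring {R L : Type*} [CommRing R] [Field L] [Algebra R L] {x : L}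
    (hx : IsIntegral R x) (V : ValuationSubring L) (hV : ∀ r, algebraMap R L r ∈ V) : x ∈ V := by
  let : Algebra R V := ((algebraMap R L).codRestrict V.toSubring hV).toAlgebra
  have : IsScalarTower R V L := IsScalarTower.of_algebraMap_eq fun _ => rfl
  obtain ⟨y, rfl⟩ := IsIntegrallyClosed.isIntegral_iff.1 (hx.tower_top (A := V))
  exact y.2

section Rational

variable {k : Type*} {L : Type u} [Field k] [Field L] [Algebra k L] (t : L)

/-- A quotient of `k[X]`. This is what makes the integral closure of `k[t]` in a finite separable
extension a Dedekind domain. -/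
instance Algebra.adjoin_singleton_isPrincipalIdealRing :
    IsPrincipalIdealRing (Algebra.adjoin k {t}) := by
  have h : ∀ p : k[X], aeval t p ∈ Algebra.adjoin k {t} := fun p =>
    Algebra.adjoin_singleton_eq_range_aeval k t ▸ ⟨p, rfl⟩
  refine IsPrincipalIdealRing.of_surjective ((aeval t).codRestrict (Algebra.adjoin k {t}) h)
    fun ⟨y, hy⟩ => ?_
  rw [Algebra.adjoin_singleton_eq_range_aeval] at hy
  obtain ⟨p, rfl⟩ := hy
  exact ⟨p, rfl⟩

open scoped IntermediateField.algebraAdjoinAdjoin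

/-- The discrete valuations of a finite separable extension of `k(t)` which are nonnegative
on `t`. -/
theorem exists_valuations_integral_adjoin [FiniteDimensional k⟮t⟯ L] [Algebra.IsSeparable k⟮t⟯ L] :
    ∃ (ι : Type u) (v : ι → Valuation L ℤᵐ⁰), (∀ x ≠ 0, {i | v i x ≠ 1}.Finite) ∧
      ∀ x, (∀ i, v i x ≤ 1) ↔ IsIntegral (Algebra.adjoin k {t}) x := by
  let R := Algebra.adjoin k {t}
  have : IsDedekindDomain (integralClosure R L) := integralClosure.isDedekindDomain R k⟮t⟯ L
  have : IsFractionRing (integralClosure R L) L :=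
    IsIntegralClosure.isFractionRing_of_finite_extension R k⟮t⟯ L _
  refine ⟨IsDedekindDomain.HeightOneSpectrum (integralClosure R L), fun P => P.valuation L,
    fun x hx => ?_, fun x => ⟨fun h => ?_, fun h P => ?_⟩⟩
  · refine ((IsDedekindDomain.HeightOneSpectrum.Support.finite (integralClosure R L) x).union
      (IsDedekindDomain.HeightOneSpectrum.Support.finite (integralClosure R L) x⁻¹)).subset ?_
    intro P hP
    rcases lt_or_gt_of_ne hP with h | h
    · refine Or.inr ?_
      change 1 < P.valuation L x⁻¹
      rw [map_inv₀]
      exact (one_lt_inv₀ (by simpa [zero_lt_iff] using hx)).2 h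
    · exact Or.inl h
  · obtain ⟨y, rfl⟩ := IsDedekindDomain.HeightOneSpectrum.mem_integers_of_valuation_le_one L x h
    exact y.2
  · exact P.valuation_le_one (⟨x, h⟩ : integralClosure R L)

end Rational

/-- The discrete valuations of a function field in one variable over a perfect field. -/
theorem exists_valuations_of_trdeg_eq_one (k : Type*) (L : Type u) [Field k] [PerfectField k]
    [Field L] [Algebra k L] [Algebra.EssFiniteType k L] (h1 : Algebra.trdeg k L = 1) :
    ∃ (ι : Type u) (v : ι → Valuation L ℤᵐ⁰), (∀ x ≠ 0, {i | v i x ≠ 1}.Finite) ∧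
      ∀ x, (∀ i, v i x ≤ 1) ↔ IsIntegral k x := by
  obtain ⟨s, hs, hsep⟩ := exists_isTranscendenceBasis_and_isSeparable_of_perfectField k L
  have hcard : s.card = 1 := by
    have := hs.cardinalMk_eq_trdeg
    rw [h1] at this
    simpa using this
  obtain ⟨t, rfl⟩ := Finset.card_eq_one.1 hcard
  rw [Finset.coe_singleton] at hsep
  have hinv : k⟮t⁻¹⟯ = k⟮t⟯ := by
    refine le_antisymm (adjoin_simple_le_iff.2 (inv_mem (mem_adjoin_simple_self k t)))
      (adjoin_simple_le_iff.2 ?_)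
    simpa using inv_mem (mem_adjoin_simple_self k t⁻¹)
  have hfin (u : L) (hu : k⟮u⟯ = k⟮t⟯) :
      FiniteDimensional k⟮u⟯ L ∧ Algebra.IsSeparable k⟮u⟯ L := by
    rw [hu]
    have : Algebra.EssFiniteType k⟮t⟯ L := Algebra.EssFiniteType.of_comp k _ L
    exact ⟨Algebra.finite_of_essFiniteType_of_isAlgebraic, hsep⟩
  obtain ⟨_, _⟩ := hfin t rfl
  obtain ⟨_, _⟩ := hfin t⁻¹ hinv
  obtain ⟨ι, v, hv, hv'⟩ := exists_valuations_integral_adjoin (k := k) t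
  obtain ⟨κ, w, hw, hw'⟩ := exists_valuations_integral_adjoin (k := k) t⁻¹
  -- The places where both `t` and `t⁻¹` are finite occur twice, which is harmless: no product
  -- formula is used.
  refine ⟨ι ⊕ κ, Sum.elim v w, fun x hx => ?_, fun x => ⟨fun h => ?_, fun h => ?_⟩⟩
  · refine (((hv x hx).image Sum.inl).union ((hw x hx).image Sum.inr)).subset ?_
    rintro (i | i) hi
    exacts [Or.inl ⟨i, hi, rfl⟩, Or.inr ⟨i, hi, rfl⟩]
  · have hmem (V : ValuationSubring L) (hV : ∀ r, algebraMap k L r ∈ V) (u : L) (hu : u ∈ V)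
        (r : Algebra.adjoin k {u}) : algebraMap (Algebra.adjoin k {u}) L r ∈ V := by
      obtain ⟨r, hr⟩ := r
      change r ∈ V
      induction hr using Algebra.adjoin_induction with
      | mem y hy => rw [Set.mem_singleton_iff.1 hy]; exact hu
      | algebraMap c => exact hV c
      | add y z _ _ hy hz => exact V.add_mem _ _ hy hz
      | mul y z _ _ hy hz => exact V.mul_mem _ _ hy hz
    refine isIntegral_of_forall_mem_valuationSubring fun V hV => ?_
    -- Every valuation ring over `k` contains `t` or `t⁻¹`, so the two families cover all of them.
    rcases V.mem_or_inv_mem t with ht | ht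
    · exact ((hv' x).1 fun i => h (Sum.inl i)).mem_valuationSubring V (hmem V hV t ht)
    · exact ((hw' x).1 fun i => h (Sum.inr i)).mem_valuationSubring V (hmem V hV _ ht)
  · rintro (i | i)
    exacts [(hv' x).2 h.tower_top i, (hw' x).2 h.tower_top i]

end FunctionField

/-! ### The ring `A` as an integral closure of a polynomial ring -/

section AffineRing

open Polynomial IntermediateField

variable {Fq E : Type*} [Field Fq] [Finite Fq] [Field E] [Algebra Fq E]

/-- A function field in one variable is finite over the subfield generated by a transcendental
element. -/
theorem IsCurveFunctionField.finiteDimensional {Fq E : Type*} [Field Fq] [Field E] [Algebra Fq E]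
    (hE : IsCurveFunctionField Fq E) {t : E}
    (ht : Transcendental Fq t) : FiniteDimensional Fq⟮t⟯ E := by
  have hb : IsTranscendenceBasis Fq (fun _ : Unit => t) :=
    (algebraicIndependent_unique_type_iff.2 ht).isTranscendenceBasis_of_lift_trdeg_le_of_finite
      (by simp [hE.2])
  have : Algebra.IsAlgebraic Fq⟮t⟯ E := by
    have := hb.isAlgebraic_field
    rwa [Set.range_const] at this
  have : Algebra.EssFiniteType Fq E := IntermediateField.fg_top_iff.1 hE.1
  have : Algebra.EssFiniteType Fq⟮t⟯ E := Algebra.EssFiniteType.of_comp Fq _ E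
  exact Algebra.finite_of_essFiniteType_of_isAlgebraic

variable {infty : ValuationSubring E}

/-- A nonconstant function which is regular away from `∞` has a pole at `∞`. -/
theorem affineRing.notMem_infty {t : affineRing Fq infty} (ht : Transcendental Fq (t : E)) :
    (t : E) ∉ infty := by
  intro h
  refine ht (IsIntegral.isAlgebraic (isIntegral_of_forall_mem_valuationSubring fun V _ => ?_))
  rcases eq_or_ne V ⊤ with rfl | hV
  · trivial
  rcases eq_or_ne V infty with rfl | hV'
  · exact h
  · exact t.2 V hV hV'

/-- The ring of functions regular away from `∞` is the integral closure of the polynomial ring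
generated by any of its nonconstant elements. -/
theorem affineRing.mem_iff_isIntegral {t : affineRing Fq infty} (ht : Transcendental Fq (t : E))
    {x : E} : x ∈ affineRing Fq infty ↔ IsIntegral (Algebra.adjoin Fq {(t : E)}) x := by
  have hsub : Algebra.adjoin Fq {(t : E)} ≤ affineRing Fq infty :=
    Algebra.adjoin_le (Set.singleton_subset_iff.2 t.2)
  constructor
  · refine fun hx => isIntegral_of_forall_mem_valuationSubring fun V hV => ?_
    rcases eq_or_ne V ⊤ with rfl | hV'
    · trivial
    · refine hx V hV' ?_
      rintro rfl
      exact affineRing.notMem_infty ht (hV ⟨t, Algebra.self_mem_adjoin_singleton Fq _⟩)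
  · exact fun hx V h1 h2 => hx.mem_valuationSubring V fun r => hsub r.2 V h1 h2

theorem affineRing.toSubring_eq {t : affineRing Fq infty} (ht : Transcendental Fq (t : E)) :
    (affineRing Fq infty).toSubring =
      (integralClosure (Algebra.adjoin Fq {(t : E)}) E).toSubring := by
  ext x
  exact affineRing.mem_iff_isIntegral ht

open scoped IntermediateField.algebraAdjoinAdjoin

/-- `E` is not assumed separable over `Fq(t)`, so being Noetherian is kept as a hypothesis; it is
supplied by the action of `A` on `φ(K)`, through `Module.IsTame.isNoetherianRing`. -/
theorem affineRing.isDedekindDomain (hE : IsCurveFunctionField Fq E) {t : affineRing Fq infty}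
    (ht : Transcendental Fq (t : E)) [IsNoetherianRing (affineRing Fq infty)] :
    IsDedekindDomain (affineRing Fq infty) := by
  have := hE.finiteDimensional ht
  have key : ∀ S : Subring E, S = (integralClosure (Algebra.adjoin Fq {(t : E)}) E).toSubring →
      IsIntegrallyClosed S ∧ Ring.DimensionLEOne S := by
    rintro _ rfl
    exact ⟨integralClosure.isIntegrallyClosedOfFiniteExtension Fq⟮(t : E)⟯,
      Ring.DimensionLEOne.integralClosure (Algebra.adjoin Fq {(t : E)}) E⟩
  obtain ⟨h1, h2⟩ := key _ (affineRing.toSubring_eq ht)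
  have h1 : IsIntegrallyClosed (affineRing Fq infty) := h1
  have h2 : Ring.DimensionLEOne (affineRing Fq infty) := h2
  exact { }

/-- The ring of functions regular away from `∞` has finite rank over the polynomial ring generated
by any of its nonconstant elements. -/
theorem affineRing.exists_finite_family (hE : IsCurveFunctionField Fq E) {t : affineRing Fq infty}
    (ht : Transcendental Fq (t : E)) : ∃ (n : ℕ) (a : Fin n → affineRing Fq infty),
      ∀ x : affineRing Fq infty, ∃ p : Fq[X], p ≠ 0 ∧ ∃ c : Fin n → Fq[X],
        aeval t p * x = ∑ j, aeval t (c j) * a j := by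
  have := hE.finiteDimensional ht
  set R := Algebra.adjoin Fq {(t : E)} with hR
  obtain ⟨s, b, hb⟩ := FiniteDimensional.exists_is_basis_integral R Fq⟮(t : E)⟯ E
  let e := s.equivFin
  refine ⟨s.card, fun j => ⟨b (e.symm j), (affineRing.mem_iff_isIntegral ht).2 (hb _)⟩,
    fun x => ?_⟩
  -- A common denominator for the coordinates of `x` in a basis of `E` made of integral elements.
  obtain ⟨d, hd⟩ := IsLocalization.exist_integer_multiples_of_finite (nonZeroDivisors R)
    fun j => b.repr (x : E) (e.symm j)
  choose r hr using hd
  have hpoly (y : R) : ∃ p : Fq[X], aeval (t : E) p = y := by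
    obtain ⟨y, hy⟩ := y
    rw [hR, Algebra.adjoin_singleton_eq_range_aeval] at hy
    exact hy
  obtain ⟨p, hp⟩ := hpoly d
  choose c hc using fun j => hpoly (r j)
  refine ⟨p, ?_, c, Subtype.ext ?_⟩
  · rintro rfl
    rw [map_zero] at hp
    exact nonZeroDivisors.coe_ne_zero d (Subtype.ext hp.symm)
  · have h1 (j) : (r j : E) = (d : R) * (b.repr (x : E) (e.symm j) : E) := by
      have := congrArg (algebraMap Fq⟮(t : E)⟯ E) (hr j)
      rw [Algebra.smul_def, map_mul] at this
      exact this
    push_cast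
    rw [hp]
    conv_lhs => rw [← b.sum_repr (x : E), Finset.mul_sum, ← e.symm.sum_comp]
    refine Finset.sum_congr rfl fun j _ => ?_
    rw [hc, h1, Algebra.smul_def, mul_assoc]
    rfl

/-- A nonzero function regular away from `∞` divides a nonzero polynomial in any given nonconstant
one. -/
theorem affineRing.exists_dvd_aeval (hE : IsCurveFunctionField Fq E) {t : affineRing Fq infty}
    (ht : Transcendental Fq (t : E)) {a : affineRing Fq infty} (ha : a ≠ 0) :
    ∃ p : Fq[X], p ≠ 0 ∧ a ∣ aeval t p := by
  have := hE.finiteDimensional ht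
  have halg : Algebra.IsAlgebraic (Algebra.adjoin Fq {(t : E)}) E :=
    (IsFractionRing.comap_isAlgebraic_iff (K := Fq⟮(t : E)⟯)).2 inferInstance
  -- A nonzero multiple `d * a⁻¹` with `d` in `Fq[t]` is integral, hence lies in `A`; thus `a`
  -- divides `d`.
  obtain ⟨⟨d, hd⟩, hd0, hint⟩ := (halg.isAlgebraic (a : E)⁻¹).exists_integral_multiple
  have hd' := hd
  rw [Algebra.adjoin_singleton_eq_range_aeval] at hd'
  obtain ⟨p, rfl⟩ := hd'
  refine ⟨p, ?_, ⟨_, (affineRing.mem_iff_isIntegral ht).2 hint⟩, Subtype.ext ?_⟩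
  · rintro rfl
    exact hd0 (Subtype.ext (map_zero (aeval (t : E))))
  · have ha' : (a : E) ≠ 0 := fun h => ha (Subtype.ext h)
    push_cast
    change aeval (t : E) p = a * (aeval (t : E) p * (a : E)⁻¹)
    field_simp

end AffineRing

/-! ### Passing from `F_q[t]` to `A` -/

section Transfer

variable {R A M : Type*} [CommRing R] [IsDomain R] [CommRing A] [IsDomain A] [Algebra R A]
  [AddCommGroup M] [Module R M] [Module A M] [IsScalarTower R A M]

/-- When `A` has finite rank over `R`, the isolated closure of a finitely generated `A`-submodule is
contained in that of a finitely generated `R`-submodule. -/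
theorem Submodule.exists_fg_isolated_le
    (hfin : ∃ (n : ℕ) (a : Fin n → A), ∀ x : A, ∃ p : R, p ≠ 0 ∧ ∃ c : Fin n → R,
      p • x = ∑ j, c j • a j)
    (hdvd : ∀ a : A, a ≠ 0 → ∃ p : R, p ≠ 0 ∧ a ∣ algebraMap R A p)
    {N : Submodule A M} (hN : N.FG) :
    ∃ N' : Submodule R M, N'.FG ∧ N.isolated.restrictScalars R ≤ N'.isolated := by
  obtain ⟨s, m, rfl⟩ := Submodule.fg_iff_exists_fin_generating_family.1 hN
  obtain ⟨n, a, ha⟩ := hfin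
  let N' := Submodule.span R (Set.range fun ij : Fin s × Fin n => a ij.2 • m ij.1)
  refine ⟨N', Submodule.fg_span (Set.finite_range _), fun x hx => ?_⟩
  obtain ⟨b, hb, hbx⟩ := Submodule.mem_isolated.1 hx
  have hsub : ∀ y ∈ Submodule.span A (Set.range m), y ∈ N'.isolated := by
    intro y hy
    obtain ⟨α, rfl⟩ := (Submodule.mem_span_range_iff_exists_fun _).1 hy
    refine Submodule.sum_mem _ fun i _ => ?_
    obtain ⟨p, hp, c, hc⟩ := ha (α i)
    refine Submodule.mem_isolated.2 ⟨p, hp, ?_⟩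
    rw [← smul_assoc, hc, Finset.sum_smul]
    refine Submodule.sum_mem _ fun j _ => ?_
    rw [smul_assoc]
    exact Submodule.smul_mem _ _ (Submodule.subset_span ⟨(i, j), rfl⟩)
  obtain ⟨p, hp, b', hb'⟩ := hdvd b hb
  rw [← Submodule.isolated_isolated]
  refine Submodule.mem_isolated.2 ⟨p, hp, hsub _ ?_⟩
  rw [← algebraMap_smul A p x, hb', mul_comm, mul_smul]
  exact Submodule.smul_mem _ _ hbx

/-- The isolated closure over `A` lies in a finitely generated module over the Noetherian ring `R`,
so it is finitely generated over `R`, and a fortiori over `A`. -/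
theorem Module.IsTame.of_finite_rank [IsNoetherianRing R] (ht : Module.IsTame R M)
    (hfin : ∃ (n : ℕ) (a : Fin n → A), ∀ x : A, ∃ p : R, p ≠ 0 ∧ ∃ c : Fin n → R,
      p • x = ∑ j, c j • a j)
    (hdvd : ∀ a : A, a ≠ 0 → ∃ p : R, p ≠ 0 ∧ a ∣ algebraMap R A p) : Module.IsTame A M := by
  intro N hN
  obtain ⟨N', hN', hle⟩ := Submodule.exists_fg_isolated_le hfin hdvd hN
  exact Submodule.FG.of_restrictScalars (R := R) (Submodule.FG.of_le (ht N' hN') hle)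

theorem Module.IsInfiniteRank.of_finite_rank (hi : Module.IsInfiniteRank R M)
    (hfin : ∃ (n : ℕ) (a : Fin n → A), ∀ x : A, ∃ p : R, p ≠ 0 ∧ ∃ c : Fin n → R,
      p • x = ∑ j, c j • a j)
    (hdvd : ∀ a : A, a ≠ 0 → ∃ p : R, p ≠ 0 ∧ a ∣ algebraMap R A p) :
    Module.IsInfiniteRank A M := by
  intro N hN htop
  obtain ⟨N', hN', hle⟩ := Submodule.exists_fg_isolated_le hfin hdvd hN
  exact hi N' hN' (eq_top_iff.2 fun x _ => hle (by rw [htop]; trivial))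

/-- A ring of finite rank over a Noetherian domain which acts on a tame module of infinite rank is
Noetherian. -/
theorem Module.IsTame.isNoetherianRing [IsNoetherianRing R] (ht : Module.IsTame R M)
    (hi : Module.IsInfiniteRank R M)
    (hfin : ∃ (n : ℕ) (a : Fin n → A), ∀ x : A, ∃ p : R, p ≠ 0 ∧ ∃ c : Fin n → R,
      p • x = ∑ j, c j • a j)
    (hdvd : ∀ a : A, a ≠ 0 → ∃ p : R, p ≠ 0 ∧ a ∣ algebraMap R A p) : IsNoetherianRing A := by
  -- For a nontorsion element `x`, the map `a ↦ a • x` embeds `A` in the isolated closure of a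
  -- finitely generated `R`-submodule, which tameness makes a Noetherian `R`-module.
  obtain ⟨x, -, hx⟩ := SetLike.exists_of_lt (lt_top_iff_ne_top.2 (hi ⊥ Submodule.fg_bot))
  have hinj (a : A) (ha : a • x = 0) : a = 0 := by
    by_contra h0
    obtain ⟨p, hp, b, hb⟩ := hdvd a h0
    refine hx (Submodule.mem_isolated.2 ⟨p, hp, ?_⟩)
    rw [← algebraMap_smul A p x, hb, mul_comm, mul_smul, ha, smul_zero]
    exact zero_mem _
  obtain ⟨N', hN', hle⟩ := Submodule.exists_fg_isolated_le hfin hdvd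
    (Submodule.fg_span_singleton (R := A) x)
  let f : A →ₗ[R] N'.isolated := LinearMap.codRestrict _
    ((LinearMap.toSpanSingleton A M x).restrictScalars R) fun a =>
      hle (Submodule.le_isolated _ (Submodule.smul_mem _ a (Submodule.mem_span_singleton_self x)))
  have : IsNoetherian R N'.isolated := isNoetherian_of_fg_of_noetherian _ (ht N' hN')
  have : IsNoetherian R A := isNoetherian_of_injective f <| (injective_iff_map_eq_zero f).2
    fun a ha => hinj a (congrArg Subtype.val ha)
  exact isNoetherianRing_iff.2 (isNoetherian_of_tower R this)

/-- A tame module with arbitrarily large finite linearly independent families has infinite rank. -/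
theorem Module.IsTame.isInfiniteRank (ht : Module.IsTame R M)
    (h : ∀ n : ℕ, ∃ x : Fin n → M, LinearIndependent R x) : Module.IsInfiniteRank R M := by
  intro N hN htop
  have : Module.Finite R M := ⟨htop ▸ ht N hN⟩
  obtain ⟨x, hx⟩ := h (Module.finrank R M + 1)
  have := hx.fintype_card_le_finrank
  rw [Fintype.card_fin] at this
  omega

end Transfer

/-! ### Reduction to a function field in one variable -/

section EscapeField

open Polynomial WithZero IntermediateField

/-- For subrings of `Ω` that are nested as sets but carry no algebra structure over one another. -/
theorem IsAlgebraic.of_subset {R₁ R₂ Ω : Type*} [CommRing R₁] [CommRing R₂] [CommRing Ω]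
    [Algebra R₁ Ω] [Algebra R₂ Ω] [FaithfulSMul R₁ Ω] [FaithfulSMul R₂ Ω]
    (h : Set.range (algebraMap R₁ Ω) ⊆ Set.range (algebraMap R₂ Ω))
    {x : Ω} (hx : IsAlgebraic R₁ x) : IsAlgebraic R₂ x := by
  have hinj := FaithfulSMul.algebraMap_injective R₂ Ω
  have hinj₁ := FaithfulSMul.algebraMap_injective R₁ Ω
  choose g hg using fun r : R₁ => h ⟨r, rfl⟩
  let f : R₁ →+* R₂ :=
    { toFun := g
      map_one' := hinj (by rw [hg, map_one, map_one])
      map_mul' := fun a b => hinj (by rw [hg, map_mul, map_mul, hg, hg])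
      map_zero' := hinj (by rw [hg, map_zero, map_zero])
      map_add' := fun a b => hinj (by rw [hg, map_add, map_add, hg, hg]) }
  let : Algebra R₁ R₂ := f.toAlgebra
  have : IsScalarTower R₁ R₂ Ω := IsScalarTower.of_algebraMap_eq fun r => (hg r).symm
  refine hx.extendScalars (S := R₂) fun a b hab => hinj₁ ?_
  rw [← hg a, ← hg b]
  exact congrArg _ hab

/-- An extension field of an algebraically closed subfield over which a given transcendental
element is a transcendence basis. -/
theorem exists_isAlgClosed_trdeg_eq_one {F Ω : Type*} [Field F] [Field Ω] [Algebra F Ω]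
    [IsAlgClosed Ω] {l : Ω} (hl : Transcendental F l) :
    ∃ F₁ : Subfield Ω, (∀ c : F, algebraMap F Ω c ∈ F₁) ∧ IsAlgClosed F₁ ∧
      Transcendental F₁ l ∧ Algebra.trdeg F₁ Ω = 1 := by
  have hind : AlgebraicIndepOn F id ({l} : Set Ω) :=
    (algebraicIndependent_unique_type_iff (ι := ({l} : Set Ω))).2 hl
  -- Extend `l` to a transcendence basis of `Ω` over `F`; the field sought is the algebraic closure
  -- in `Ω` of the field generated by the other basis elements.
  obtain ⟨s, hls, hs⟩ := exists_isTranscendenceBasis_superset hind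
  have hl' : l ∈ s := hls rfl
  set F' := adjoin F (s \ {l})
  have hF' : Transcendental F' l := by
    have := hs.1.transcendental_adjoin (s := {⟨l, hl'⟩}ᶜ) (i := ⟨l, hl'⟩) (by simp)
    have himg : (Subtype.val '' ({⟨l, hl'⟩}ᶜ : Set s)) = s \ {l} := by
      ext y
      simp only [Set.mem_image, Set.mem_compl_iff, Set.mem_singleton_iff, Subtype.exists,
        Subtype.mk.injEq, exists_and_right, exists_eq_right, Set.mem_sdiff]
      exact ⟨fun ⟨h1, h2⟩ => ⟨h1, h2⟩, fun ⟨h1, h2⟩ => ⟨h1, h2⟩⟩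
    rw [himg] at this
    exact fun h => this (isAlgebraic_adjoin_iff.1 h)
  let k := algebraicClosure F' Ω
  have hk : IsAlgClosed k := IsAlgClosure.isAlgClosed F'
  have hlk : Transcendental k l := hF'.algebraicClosure
  refine ⟨k.toSubfield, fun c => k.algebraMap_mem (algebraMap F F' c), hk, hlk, ?_⟩
  have hkb : IsTranscendenceBasis k (fun _ : Unit => l) := by
    refine (algebraicIndependent_unique_type_iff.2 hlk).isTranscendenceBasis_iff_isAlgebraic.2
      ⟨fun x => ?_⟩
    rw [Set.range_const]
    refine isAlgebraic_adjoin_iff.1 ?_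
    have := hs.isAlgebraic_field
    rw [Subtype.range_coe] at this
    refine IsAlgebraic.of_subset ?_ (this.isAlgebraic x)
    rintro _ ⟨⟨y, hy⟩, rfl⟩
    refine ⟨⟨y, ?_⟩, rfl⟩
    induction hy using adjoin_induction with
    | mem z hz =>
      by_cases hzl : z = l
      · exact hzl ▸ mem_adjoin_simple_self _ _
      · exact k⟮l⟯.algebraMap_mem (⟨z, k.algebraMap_mem (⟨z, subset_adjoin F _ ⟨hz, hzl⟩⟩ : F')⟩ : k)
    | algebraMap c => exact k⟮l⟯.algebraMap_mem (algebraMap F' k (algebraMap F F' c))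
    | add y z _ _ hy hz => exact add_mem hy hz
    | mul y z _ _ hy hz => exact mul_mem hy hz
    | inv y _ hy => exact inv_mem hy
  have := hkb.lift_cardinalMk_eq_trdeg
  have h2 : Algebra.trdeg k Ω = 1 := by simpa using this.symm
  exact h2

/-- `L` is `F₁(S)`, a function field in one variable because `l` belongs to `S`. As `F₁` is
algebraically closed, it is perfect, and the elements without poles, being integral over it, lie in
it. -/
theorem exists_valuations_of_transcendental {F : Type*} {Ω : Type u} [Field F] [Field Ω]
    [Algebra F Ω] [IsAlgClosed Ω] {l : Ω} (hl : Transcendental F l) {S : Set Ω} (hS : S.Finite)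
    (hlS : l ∈ S) :
    ∃ (F₁ L : Subfield Ω) (ι : Type u) (v : ι → Valuation L ℤᵐ⁰),
      (∀ c : F, algebraMap F Ω c ∈ F₁) ∧ F₁ ≤ L ∧ S ⊆ L ∧ (∀ x : Ω, IsAlgebraic F₁ x → x ∈ F₁) ∧
      l ∉ F₁ ∧ (∀ x : L, x ≠ 0 → {i | v i x ≠ 1}.Finite) ∧
      ∀ x : L, (∀ i, v i x ≤ 1) ↔ (x : Ω) ∈ F₁ := by
  obtain ⟨F₁, hF, hF₁, hl₁, htr⟩ := exists_isAlgClosed_trdeg_eq_one hl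
  let L := adjoin F₁ S
  have hL : Algebra.EssFiniteType F₁ L := essFiniteType_iff.2 (fg_adjoin_of_finite hS)
  have hclosed (x : Ω) (hx : IsAlgebraic F₁ x) : x ∈ F₁ := by
    obtain ⟨y, hy⟩ := minpoly.mem_range_of_degree_eq_one F₁ x
      (IsAlgClosed.degree_eq_one_of_irreducible F₁ (minpoly.irreducible hx.isIntegral))
    exact hy ▸ y.2
  have hlF : l ∉ F₁ := fun h => hl₁ (isAlgebraic_algebraMap (⟨l, h⟩ : F₁))
  have htrL : Algebra.trdeg F₁ L = 1 := by
    refine le_antisymm (htr ▸ trdeg_le_of_injective (IsScalarTower.toAlgHom F₁ L Ω)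
      Subtype.val_injective) ?_
    rw [Cardinal.one_le_iff_ne_zero, Ne, trdeg_eq_zero_iff]
    intro h
    exact hlF (hclosed l (h.isAlgebraic (⟨l, subset_adjoin _ _ hlS⟩ : L)).algebraMap)
  obtain ⟨ι, v, hv, hv'⟩ := exists_valuations_of_trdeg_eq_one F₁ L htrL
  refine ⟨F₁, L.toSubfield, ι, v, hF, fun x hx => L.algebraMap_mem (⟨x, hx⟩ : F₁),
    subset_adjoin _ _, hclosed, hlF, hv, fun x => (hv' x).trans ⟨fun h => ?_, fun h => ?_⟩⟩
  · exact hclosed _ (h.isAlgebraic.algebraMap (A := Ω))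
  · exact isIntegral_algebraMap (R := F₁) (A := L) (x := ⟨x, h⟩)

end EscapeField

/-! ### Coefficients of twisted polynomials -/

namespace TwistedPoly

section Coeff

variable {Fq K : Type*} [Field Fq] [Finite Fq] [Field K] [Algebra Fq K]

theorem frobq_pow_apply (n : ℕ) (x : K) : (frobq Fq K ^ n) x = x ^ Nat.card Fq ^ n := by
  induction n with
  | zero => simp
  | succ n ih => rw [pow_succ', RingHom.mul_def, RingHom.comp_apply, ih, frobq_apply, ← pow_mul,
      ← pow_succ]

theorem ext_coeff {f g : TwistedPoly Fq K} (h : ∀ n, f.coeff n = g.coeff n) : f = g :=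
  SkewPolynomial.ext h

theorem mem_support {f : TwistedPoly Fq K} {n : ℕ} : n ∈ f.support ↔ f.coeff n ≠ 0 :=
  SkewPolynomial.mem_support_iff

theorem coeff_add (f g : TwistedPoly Fq K) (n : ℕ) : (f + g).coeff n = f.coeff n + g.coeff n :=
  SkewPolynomial.coeff_add f g n

theorem coeff_C (c : K) (n : ℕ) : (C Fq c).coeff n = if n = 0 then c else 0 :=
  SkewPolynomial.coeff_C

theorem coeff_mul (f g : TwistedPoly Fq K) (n : ℕ) : (f * g).coeff n =
    ∑ p ∈ Finset.HasAntidiagonal.antidiagonal n, f.coeff p.1 * g.coeff p.2 ^ Nat.card Fq ^ p.1 := by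
  let := frobqAction Fq K
  have h := SkewMonoidAlgebra.coeff_mul_antidiagonal_of_finset (k := K) (G := Multiplicative ℕ) f g
    (Multiplicative.ofAdd n) ((Finset.HasAntidiagonal.antidiagonal n).map
      (Equiv.prodCongr Multiplicative.ofAdd Multiplicative.ofAdd).toEmbedding) (by
      rintro ⟨a, b⟩
      simp only [Finset.mem_map_equiv, Finset.HasAntidiagonal.mem_antidiagonal]
      rfl)
  rw [Finset.sum_map] at h
  refine h.trans (Finset.sum_congr rfl fun p _ => ?_)
  exact congrArg (f.coeff p.1 * ·) (frobq_pow_apply p.1 _)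

theorem coeff_C_mul (c : K) (f : TwistedPoly Fq K) (n : ℕ) :
    (C Fq c * f).coeff n = c * f.coeff n := by
  rw [coeff_mul, Finset.sum_eq_single (0, n)]
  · simp [coeff_C]
  · rintro ⟨a, b⟩ hab hne
    have : a ≠ 0 := by
      rintro rfl
      exact hne (by simpa using hab)
    simp [coeff_C, this]
  · simp

theorem coeff_mul_C (c : K) (f : TwistedPoly Fq K) (n : ℕ) :
    (f * C Fq c).coeff n = f.coeff n * c ^ Nat.card Fq ^ n := by
  rw [coeff_mul, Finset.sum_eq_single (n, 0)]
  · simp [coeff_C]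
  · rintro ⟨a, b⟩ hab hne
    have : b ≠ 0 := by
      rintro rfl
      exact hne (by simpa using hab)
    simp [coeff_C, this, Nat.card_pos.ne']
  · simp

theorem coeff_tau_pow (m n : ℕ) : (tau Fq K ^ m).coeff n = if m = n then 1 else 0 := by
  let := frobqAction Fq K
  have h : tau Fq K ^ m = (SkewPolynomial.monomial m (1 : K)) :=
    (SkewPolynomial.monomial_one_right_eq_X_pow m).symm
  rw [h]
  exact SkewPolynomial.coeff_monomial

variable (Fq K) in
/-- The coefficient of `τ ^ n` as an additive map. -/
def coeffHom (n : ℕ) : TwistedPoly Fq K →+ K where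
  toFun f := f.coeff n
  map_zero' := rfl
  map_add' f g := coeff_add f g n

theorem coeff_sum {ι : Type*} (s : Finset ι) (f : ι → TwistedPoly Fq K) (n : ℕ) :
    (∑ i ∈ s, f i).coeff n = ∑ i ∈ s, (f i).coeff n :=
  map_sum (coeffHom Fq K n) f s

theorem coeff_baseChange {L : Type*} [Field L] [Algebra Fq L] [Algebra K L]
    (f : TwistedPoly Fq K) (n : ℕ) :
    (baseChange Fq K L f).coeff n = algebraMap K L (f.coeff n) := by
  rw [baseChange, lift_apply, coeff_sum]
  simp only [RingHom.comp_apply, coeff_C_mul, coeff_tau_pow, mul_ite, mul_one, mul_zero,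
    Finset.sum_ite_eq']
  split_ifs with h
  · rfl
  · rw [mem_support, not_not] at h
    rw [h, map_zero]

theorem coeff_conj (γ : Kˣ) (f : TwistedPoly Fq K) (n : ℕ) :
    (conj γ f).coeff n = ((γ⁻¹ : Kˣ) : K) * f.coeff n * (γ : K) ^ Nat.card Fq ^ n := by
  change (C Fq ((γ⁻¹ : Kˣ) : K) * f * C Fq (γ : K)).coeff n = _
  rw [coeff_mul_C, coeff_C_mul]

theorem evalHom_C (c x : K) : evalHom (C Fq c) x = c * x := by
  rw [evalHom_apply]
  rcases eq_or_ne c 0 with rfl | hc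
  · rw [zero_mul]
    exact Finset.sum_eq_zero fun n _ => by rw [coeff_C, ite_self, zero_mul]
  · rw [Finset.sum_eq_single 0]
    · simp [coeff_C]
    · intro n _ hn
      simp [coeff_C, hn]
    · intro h
      rw [mem_support, coeff_C, if_pos rfl, not_not] at h
      exact absurd h hc

theorem evalHom_eq_sum_range {f : TwistedPoly Fq K} {d : ℕ} (hf : ∀ n, d < n → f.coeff n = 0)
    (x : K) : evalHom f x = ∑ n ∈ Finset.range (d + 1), f.coeff n * x ^ Nat.card Fq ^ n := by
  rw [evalHom_apply]
  refine Finset.sum_subset (fun n hn => ?_) fun n _ hn => ?_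
  · rw [Finset.mem_range]
    by_contra! h
    exact mem_support.1 hn (hf n (by omega))
  · rw [mem_support, not_not] at hn
    rw [hn, zero_mul]

theorem evalHom_baseChange {L : Type*} [Field L] [Algebra Fq L] [Algebra K L]
    (f : TwistedPoly Fq K) (x : K) :
    evalHom (baseChange Fq K L f) (algebraMap K L x) = algebraMap K L (evalHom f x) := by
  have hf : ∀ n, f.support.sup id < n → f.coeff n = 0 := by
    intro n hn
    by_contra h
    exact (Finset.le_sup (f := id) (mem_support.2 h)).not_gt hn
  rw [evalHom_eq_sum_range hf, evalHom_eq_sum_range (d := f.support.sup id), map_sum]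
  · simp only [coeff_baseChange, map_mul, map_pow]
  · intro n hn
    rw [coeff_baseChange, hf n hn, map_zero]

theorem evalHom_conj (γ : Kˣ) (f : TwistedPoly Fq K) (x : K) :
    evalHom (conj γ f) x = ((γ⁻¹ : Kˣ) : K) * evalHom f (γ * x) := by
  change evalHom (C Fq ((γ⁻¹ : Kˣ) : K) * f * C Fq (γ : K)) x = _
  rw [map_mul, map_mul, AddMonoid.End.coe_mul, Function.comp_apply, AddMonoid.End.coe_mul,
    Function.comp_apply, evalHom_C, evalHom_C]

end Coeff

/-! ### Degrees and commuting twisted polynomials -/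

section Degree

variable {Fq K : Type*} [Field Fq] [Finite Fq] [Field K] [Algebra Fq K]

/-- `f` has degree `d` in `τ`. -/
def HasDegree (f : TwistedPoly Fq K) (d : ℕ) : Prop :=
  f.coeff d ≠ 0 ∧ ∀ n, d < n → f.coeff n = 0

theorem exists_hasDegree_of_coeff_ne_zero {f : TwistedPoly Fq K} {n : ℕ} (h : f.coeff n ≠ 0) :
    ∃ d, n ≤ d ∧ f.HasDegree d := by
  have hne : f.support.Nonempty := ⟨n, mem_support.2 h⟩
  refine ⟨f.support.max' hne, Finset.le_max' _ _ (mem_support.2 h),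
    mem_support.1 (Finset.max'_mem _ _), fun m hm => ?_⟩
  by_contra h'
  exact (Finset.le_max' _ _ (mem_support.2 h')).not_gt hm

theorem HasDegree.mul {f g : TwistedPoly Fq K} {d e : ℕ} (hf : f.HasDegree d)
    (hg : g.HasDegree e) : (f * g).HasDegree (d + e) := by
  constructor
  · rw [coeff_mul, Finset.sum_eq_single (d, e)]
    · exact mul_ne_zero hf.1 (pow_ne_zero _ hg.1)
    · rintro ⟨a, b⟩ hab hne
      rw [Finset.HasAntidiagonal.mem_antidiagonal] at hab
      rcases lt_trichotomy d a with h | rfl | h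
      · rw [hf.2 a h, zero_mul]
      · exact absurd (by rw [show b = e by simpa using hab]) hne
      · rw [hg.2 b (by dsimp only at hab; omega), zero_pow (pow_ne_zero _ Nat.card_pos.ne'),
          mul_zero]
    · simp
  · intro n hn
    rw [coeff_mul]
    refine Finset.sum_eq_zero fun ⟨a, b⟩ hab => ?_
    rw [Finset.HasAntidiagonal.mem_antidiagonal] at hab
    dsimp only at hab ⊢
    rcases lt_or_ge d a with h | h
    · rw [hf.2 a h, zero_mul]
    · rw [hg.2 b (by omega), zero_pow (pow_ne_zero _ Nat.card_pos.ne'), mul_zero]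

theorem hasDegree_one : (1 : TwistedPoly Fq K).HasDegree 0 := by
  rw [← map_one (C Fq)]
  exact ⟨by rw [coeff_C, if_pos rfl]; exact one_ne_zero, fun n hn => by rw [coeff_C, if_neg hn.ne']⟩

theorem HasDegree.pow {f : TwistedPoly Fq K} {d : ℕ} (hf : f.HasDegree d) (m : ℕ) :
    (f ^ m).HasDegree (m * d) := by
  induction m with
  | zero => simpa using hasDegree_one
  | succ m ih => rw [pow_succ, add_mul, one_mul]; exact ih.mul hf

/-- A twisted polynomial of finite multiplicative order is constant. -/
theorem coeff_eq_zero_of_pow_eq_one {f : TwistedPoly Fq K} {m : ℕ} (hm : m ≠ 0) (hf : f ^ m = 1)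
    {n : ℕ} (hn : n ≠ 0) : f.coeff n = 0 := by
  by_contra h
  obtain ⟨d, hd, hfd⟩ := exists_hasDegree_of_coeff_ne_zero h
  have := hfd.pow m
  rw [hf] at this
  exact this.1 (hasDegree_one.2 _ (Nat.mul_pos (Nat.pos_of_ne_zero hm) (by omega)))

/-- The coefficients of a twisted polynomial which commutes with a monic one of positive degree are
algebraic over any field over which the coefficients of the latter are algebraic. -/
theorem isAlgebraic_coeff_of_commute {F : Type*} [Field F] [Algebra F K]
    {f g : TwistedPoly Fq K} {r : ℕ} (hr : r ≠ 0) (hg1 : g.coeff r = 1)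
    (hg : ∀ n, r < n → g.coeff n = 0) (hgF : ∀ n, IsAlgebraic F (g.coeff n)) (h : f * g = g * f)
    (n : ℕ) : IsAlgebraic F (f.coeff n) := by
  have hsupp : ∃ d, ∀ n, d < n → f.coeff n = 0 := by
    refine ⟨f.support.sup id, fun n hn => ?_⟩
    by_contra h'
    exact (Finset.le_sup (f := id) (mem_support.2 h')).not_gt hn
  obtain ⟨d, hd⟩ := hsupp
  let k := algebraicClosure F K
  have hq : 1 < Nat.card Fq := Finite.one_lt_card
  -- Descending induction on `n`, from above the degree of `f`.
  suffices ∀ t n, d < n + t → f.coeff n ∈ k from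
    (this (d + 1) n (by omega) : f.coeff n ∈ algebraicClosure F K).isAlgebraic
  intro t
  induction t with
  | zero => exact fun n hn => hd n hn ▸ zero_mem k
  | succ t ih =>
    intro n hn
    have hgk (m : ℕ) : g.coeff m ∈ k := mem_algebraicClosure_iff.2 (hgF m)
    have h1 : (f * g).coeff (n + r) - f.coeff n ∈ k := by
      rw [coeff_mul, ← Finset.add_sum_erase _ _ (show (n, r) ∈ Finset.HasAntidiagonal.antidiagonal (n + r) by simp)]
      dsimp only
      rw [hg1, one_pow, mul_one, add_sub_cancel_left]
      refine sum_mem fun ⟨a, b⟩ hab => ?_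
      rw [Finset.mem_erase, Finset.HasAntidiagonal.mem_antidiagonal] at hab
      dsimp only at hab ⊢
      rcases lt_trichotomy a n with ha | rfl | ha
      · rw [hg b (by omega), zero_pow (pow_ne_zero _ (by omega)), mul_zero]
        exact zero_mem k
      · exact absurd (by rw [show b = r by omega]) hab.1
      · exact mul_mem (ih a (by omega)) (pow_mem (hgk b) _)
    have h2 : (g * f).coeff (n + r) - f.coeff n ^ Nat.card Fq ^ r ∈ k := by
      rw [coeff_mul, ← Finset.add_sum_erase _ _
        (show (r, n) ∈ Finset.HasAntidiagonal.antidiagonal (n + r) by simp [add_comm])]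
      dsimp only
      rw [hg1, one_mul, add_sub_cancel_left]
      refine sum_mem fun ⟨a, b⟩ hab => ?_
      rw [Finset.mem_erase, Finset.HasAntidiagonal.mem_antidiagonal] at hab
      dsimp only at hab ⊢
      rcases lt_trichotomy b n with hb | rfl | hb
      · rw [hg a (by omega), zero_mul]
        exact zero_mem k
      · exact absurd (by rw [show a = r by omega]) hab.1
      · exact mul_mem (hgk a) (pow_mem (ih b (by omega)) _)
    rw [h] at h1
    have h3 := sub_mem h1 h2
    rw [sub_sub_sub_cancel_left] at h3
    set c : k := ⟨_, h3⟩ with hc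
    -- Comparing the coefficients of `τ ^ (n + r)` in `f * g` and `g * f` gives `f_n ^ (q ^ r) - f_n
    -- = c`, where `c` involves only `g` and the higher coefficients of `f`. This equation is monic
    -- since `q ^ r > 1`.
    have hQ : 1 < Nat.card Fq ^ r := Nat.one_lt_pow hr hq
    have halg : IsIntegral k (f.coeff n) := by
      refine ⟨Polynomial.X ^ (Nat.card Fq ^ r) - (Polynomial.X + Polynomial.C c), ?_, ?_⟩
      · refine Polynomial.monic_X_pow_sub ?_
        rw [Polynomial.degree_X_add_C]
        exact_mod_cast hQ
      · simp [hc, IntermediateField.algebraMap_apply]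
    have halg' : IsIntegral F (f.coeff n) := isIntegral_trans _ halg
    exact mem_algebraicClosure_iff.2 halg'.isAlgebraic

end Degree

end TwistedPoly

/-! ### The kernel of a separable twisted polynomial -/

namespace TwistedPoly

section Kernel

open Polynomial

variable {Fq Ω : Type*} [Field Fq] [Finite Fq] [Field Ω] [Algebra Fq Ω]

theorem natCast_card_eq_zero (Fq Ω : Type*) [Field Fq] [Finite Fq] [Field Ω] [Algebra Fq Ω] :
    ((Nat.card Fq : ℕ) : Ω) = 0 := by
  let : Fintype Fq := Fintype.ofFinite Fq
  rw [Nat.card_eq_fintype_card, ← map_natCast (algebraMap Fq Ω), FiniteField.cast_card_eq_zero,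
    map_zero]

/-- A monic twisted polynomial with nonzero constant coefficient is, as an operator on an
algebraically closed field, the product of the translations by the elements of its kernel, which is
a finite group generating a field containing all the coefficients. -/
theorem exists_finset_kernel [IsAlgClosed Ω] {g : TwistedPoly Fq Ω} {r : ℕ}
    (h1 : g.coeff r = 1) (hg : ∀ n, r < n → g.coeff n = 0) (h0 : g.coeff 0 ≠ 0) :
    ∃ Λ : Finset Ω, Λ.card = Nat.card Fq ^ r ∧ 0 ∈ Λ ∧ (∀ l ∈ Λ, ∀ m ∈ Λ, l + m ∈ Λ) ∧
      (∀ x, evalHom g x = ∏ l ∈ Λ, (x - l)) ∧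
      ∀ k : Subfield Ω, (∀ l ∈ Λ, l ∈ k) → ∀ n, g.coeff n ∈ k := by
  classical
  have hq : 1 < Nat.card Fq := Finite.one_lt_card
  set p : Polynomial Ω := ∑ n ∈ Finset.range (r + 1), Polynomial.C (g.coeff n) * X ^ (Nat.card Fq ^ n) with hp
  have hinj : Function.Injective (Nat.card Fq ^ · : ℕ → ℕ) := Nat.pow_right_injective hq
  have hcoeff (n : ℕ) : p.coeff (Nat.card Fq ^ n) = g.coeff n := by
    rw [hp, finsetSum_coeff]
    simp only [Polynomial.coeff_C_mul, coeff_X_pow, mul_ite, mul_one, mul_zero, hinj.eq_iff]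
    rw [Finset.sum_ite_eq]
    split_ifs with h
    · rfl
    · exact (hg n (by simpa using h)).symm
  have hdeg : p.natDegree ≤ Nat.card Fq ^ r := by
    refine natDegree_sum_le_of_forall_le _ _ fun n hn => ?_
    exact (natDegree_C_mul_X_pow_le _ _).trans
      (Nat.pow_le_pow_right hq.le (Nat.lt_succ_iff.1 (Finset.mem_range.1 hn)))
  have hmonic : p.Monic := monic_of_natDegree_le_of_coeff_eq_one _ hdeg (by rw [hcoeff, h1])
  have hdeg' : p.natDegree = Nat.card Fq ^ r :=
    le_antisymm hdeg (le_natDegree_of_ne_zero (by rw [hcoeff, h1]; exact one_ne_zero))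
  have heval (x : Ω) : p.eval x = evalHom g x := by
    rw [evalHom_eq_sum_range hg, hp, eval_finsetSum]
    simp
  -- As `q = 0` in `Ω`, only the linear term survives differentiation; a nonzero constant derivative
  -- makes `p` separable.
  have hder : derivative p = Polynomial.C (g.coeff 0) := by
    rw [hp, derivative_sum, Finset.sum_range_succ', Finset.sum_eq_zero]
    · simp
    · intro n _
      rw [derivative_C_mul_X_pow]
      simp [natCast_card_eq_zero Fq Ω]
  have hsep : p.Separable := by
    rw [separable_def, hder]
    exact ⟨0, Polynomial.C (g.coeff 0)⁻¹, by simp [← Polynomial.C_mul, h0]⟩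
  have hsplit : p.Splits := IsAlgClosed.splits p
  have hnodup := nodup_roots hsep
  have hmem (x : Ω) : x ∈ p.roots.toFinset ↔ evalHom g x = 0 := by
    rw [Multiset.mem_toFinset, mem_roots hmonic.ne_zero, IsRoot.def, heval]
  have hprod : p = ∏ l ∈ p.roots.toFinset, (X - Polynomial.C l) := by
    rw [Finset.prod, Multiset.toFinset_val, hnodup.dedup]
    exact hsplit.eq_prod_roots_of_monic hmonic
  refine ⟨p.roots.toFinset, ?_, ?_, ?_, ?_, ?_⟩
  · rw [Multiset.toFinset_card_of_nodup hnodup, ← hdeg']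
    exact hsplit.natDegree_eq_card_roots.symm
  · rw [hmem, map_zero]
  · intro l hl m hm
    rw [hmem] at hl hm ⊢
    rw [map_add, hl, hm, add_zero]
  · intro x
    rw [← heval]
    conv_lhs => rw [hprod]
    rw [eval_prod]
    simp
  · intro k hk n
    rw [← hcoeff, hprod]
    have : (∏ l ∈ p.roots.toFinset, (X - Polynomial.C l)) ∈ lifts k.subtype := by
      refine prod_mem fun l hl => ⟨X - Polynomial.C ⟨l, hk l hl⟩, ?_⟩
      simp
    obtain ⟨P, hP⟩ := (lifts_iff_coeff_lifts _).1 this (Nat.card Fq ^ n)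
    rw [← hP]
    exact P.2

end Kernel

end TwistedPoly

/-! ### Transcendental points of a Drinfeld module -/

namespace DrinfeldModule

section Degree

open TwistedPoly

variable {Fq A K : Type*} [Field Fq] [Finite Fq] [CommRing A] [Algebra Fq A]
  [Field K] [Algebra Fq K] {i : A →ₐ[Fq] K}

/-- The condition `i t ≠ 0` makes `φ_t` separable; it is reached by adding `1` if necessary, which
leaves the higher coefficients alone. Squaring brings the degree to at least 2, so that the kernel
has at least `q ^ 2 ≥ 4` elements even for `q = 2`. -/
theorem exists_hasDegree (φ : DrinfeldModule i) :
    ∃ (t : A) (r : ℕ), i t ≠ 0 ∧ 2 ≤ r ∧ (φ.toRingHom t).HasDegree r := by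
  obtain ⟨a, ha⟩ := φ.nontrivial
  obtain ⟨n, hn0, hn⟩ : ∃ n, n ≠ 0 ∧ (φ.toRingHom a).coeff n ≠ 0 := by
    by_contra! h
    refine ha (ext_coeff fun n => ?_)
    rw [coeff_C]
    split_ifs with h0
    · rw [h0, φ.coeff_zero]
    · exact h n h0
  obtain ⟨b, hb0, hb⟩ : ∃ b, i b ≠ 0 ∧ (φ.toRingHom b).coeff n ≠ 0 := by
    by_cases hia : i a = 0
    · refine ⟨a + 1, by simp [hia], ?_⟩
      rwa [map_add, map_one, coeff_add, hasDegree_one.2 n (Nat.pos_of_ne_zero hn0), add_zero]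
    · exact ⟨a, hia, hn⟩
  obtain ⟨d, hd, hbd⟩ := exists_hasDegree_of_coeff_ne_zero hb
  refine ⟨b ^ 2, 2 * d, by simpa using hb0, by omega, ?_⟩
  rw [map_pow]
  exact hbd.pow 2

/-- `φ` is only a ring homomorphism, but a nonzero constant is a root of unity, and a twisted
polynomial of finite order has degree zero. -/
theorem toRingHom_algebraMap (φ : DrinfeldModule i) (c : Fq) :
    φ.toRingHom (algebraMap Fq A c) = C Fq (algebraMap Fq K c) := by
  rcases eq_or_ne c 0 with rfl | hc
  · simp
  obtain ⟨m, hm, hm1⟩ := isOfFinOrder_iff_pow_eq_one.1 (isOfFinOrder_of_finite (Units.mk0 c hc))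
  have h1 : c ^ m = 1 := by simpa using congrArg Units.val hm1
  refine ext_coeff fun n => ?_
  rw [coeff_C]
  split_ifs with h0
  · rw [h0, φ.coeff_zero, AlgHom.commutes]
  · refine coeff_eq_zero_of_pow_eq_one hm.ne' ?_ h0
    rw [← map_pow, ← map_pow, h1, map_one, map_one]

theorem coeff_conj_apply (φ : DrinfeldModule i) (γ : (AlgebraicClosure K)ˣ) (a : A) (n : ℕ) :
    (φ.conj γ a).coeff n = ((γ⁻¹ : (AlgebraicClosure K)ˣ) : AlgebraicClosure K) *
      algebraMap K (AlgebraicClosure K) ((φ.toRingHom a).coeff n) *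
        (γ : AlgebraicClosure K) ^ Nat.card Fq ^ n := by
  rw [← coeff_baseChange, ← coeff_conj]
  rfl

/-- A Drinfeld module is isomorphic, over the algebraic closure, to one for which a given twisted
polynomial is monic. -/
theorem exists_conj_coeff_eq_one (φ : DrinfeldModule i) {t : A} {r : ℕ} (hr : r ≠ 0)
    (ht : (φ.toRingHom t).coeff r ≠ 0) :
    ∃ γ : (AlgebraicClosure K)ˣ, (φ.conj γ t).coeff r = 1 := by
  have hq : 1 < Nat.card Fq ^ r := Nat.one_lt_pow hr Finite.one_lt_card
  set δ := algebraMap K (AlgebraicClosure K) ((φ.toRingHom t).coeff r) with hδ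
  have hδ0 : δ ≠ 0 := (map_ne_zero _).2 ht
  obtain ⟨z, hz⟩ := IsAlgClosed.exists_pow_nat_eq δ⁻¹ (show 0 < Nat.card Fq ^ r - 1 by omega)
  have hz0 : z ≠ 0 := by
    rintro rfl
    rw [zero_pow (by omega)] at hz
    exact hδ0 (inv_eq_zero.1 hz.symm)
  refine ⟨Units.mk0 z hz0, ?_⟩
  rw [coeff_conj_apply, ← hδ]
  obtain ⟨m, hm⟩ : ∃ m, Nat.card Fq ^ r = m + 1 := ⟨_, (Nat.sub_add_cancel hq.le).symm⟩
  rw [hm, Nat.add_sub_cancel] at hz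
  rw [hm, pow_succ, Units.val_mk0, hz, Units.val_inv_eq_inv_val, Units.val_mk0]
  field_simp

theorem relModularTrdeg_eq_zero {F : Type*} [Field F] [Algebra F K] (φ : DrinfeldModule i)
    {γ : (AlgebraicClosure K)ˣ} (h : ∀ a n, IsAlgebraic F ((φ.conj γ a).coeff n)) :
    φ.relModularTrdeg F = 0 := by
  refine le_antisymm ((ciInf_le' _ γ).trans ?_) (zero_le)
  have hle : fieldOfDefinition (φ.conj γ) ≤
      (algebraicClosure F (AlgebraicClosure K)).toSubfield := by
    refine Subfield.closure_le.2 ?_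
    rintro _ ⟨a, n, rfl⟩
    exact mem_algebraicClosure_iff.2 (h a n)
  have halg : Algebra.IsAlgebraic F (IntermediateField.adjoin F
      (fieldOfDefinition (φ.conj γ) : Set (AlgebraicClosure K))) := by
    refine IntermediateField.isAlgebraic_adjoin fun x hx => ?_
    exact (mem_algebraicClosure_iff.1 (hle hx)).isIntegral
  exact (trdeg_eq_zero_iff.2 halg).le

/-- If the relative modular transcendence degree of a Drinfeld module is positive, then so is the
transcendence degree of the kernel of each of its nonconstant separable operators, once that
operator is made monic. -/
theorem exists_transcendental_of_relModularTrdeg_pos {F : Type*} [Field F] [Algebra F K]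
    (φ : DrinfeldModule i) (hφ : 0 < φ.relModularTrdeg F) {t : A} {r : ℕ} (hr : r ≠ 0)
    (ht : ∀ n, r < n → (φ.toRingHom t).coeff n = 0) {γ : (AlgebraicClosure K)ˣ}
    (hγ : (φ.conj γ t).coeff r = 1) {S : Set (AlgebraicClosure K)}
    (hS : ∀ k : Subfield (AlgebraicClosure K), S ⊆ k → ∀ n, (φ.conj γ t).coeff n ∈ k) :
    ∃ l ∈ S, Transcendental F l := by
  by_contra! h
  have hk := hS (algebraicClosure F (AlgebraicClosure K)).toSubfield fun l hl =>
    mem_algebraicClosure_iff.2 (not_not.1 (h l hl))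
  refine hφ.ne' (φ.relModularTrdeg_eq_zero (γ := γ) fun a => ?_)
  refine isAlgebraic_coeff_of_commute hr hγ (fun n hn => ?_)
    (fun n => mem_algebraicClosure_iff.1 (hk n)) ?_
  · rw [coeff_conj_apply, ht n hn, map_zero, mul_zero, zero_mul]
  · rw [← map_mul, ← map_mul, mul_comm]

end Degree

end DrinfeldModule

/-! ### The places of escape of a Drinfeld module -/

namespace DrinfeldModule

section Escape

open TwistedPoly WithZero

variable {Fq A F : Type*} {K : Type u} [Field Fq] [Finite Fq] [CommRing A] [Algebra Fq A]
  [Field K] [Algebra Fq K] {i : A →ₐ[Fq] K} [Field F] [Algebra F K]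

/-- Over a suitable function field `L`, the operator attached to a nonconstant element becomes the
product of the translations by the elements of a finite group with a pole, and `φ(K)`
embeds into `L` with values of unbounded size at some place. -/
theorem exists_isEscapeSystem (φ : DrinfeldModule i) (hK : (⊤ : IntermediateField F K).FG)
    (hφ : 0 < φ.relModularTrdeg F) {t : A} {r : ℕ} (h0 : i t ≠ 0) (hr : 2 ≤ r)
    (ht : (φ.toRingHom t).HasDegree r) :
    ∃ (L : Subfield (AlgebraicClosure K)) (ι : Type u) (v : ι → Valuation L ℤᵐ⁰) (Λ : Finset L)
      (ψ : K →+ L), IsEscapeSystem v Λ ∧ Function.Injective ψ ∧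
      (∀ x, ψ (evalHom (φ.toRingHom t) x) = ∏ l ∈ Λ, (ψ x - l)) ∧
      (∀ j, ∀ c : Fq, c ≠ 0 → ∀ x, v j (ψ (algebraMap Fq K c * x)) = v j (ψ x)) ∧
      ∃ (u : K) (j : ι) (a b : ℤᵐ⁰), 1 < a ∧ b ≠ 0 ∧ ∀ n : ℕ, v j (ψ (u ^ n)) = b * a ^ n := by
  classical
  set Ω := AlgebraicClosure K with hΩ
  have hr0 : r ≠ 0 := by omega
  obtain ⟨γ, hγ⟩ := φ.exists_conj_coeff_eq_one hr0 ht.1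
  have hγ0 : (γ : Ω) ≠ 0 := γ.ne_zero
  have hvanish : ∀ n, r < n → (φ.conj γ t).coeff n = 0 := fun n hn => by
    rw [coeff_conj_apply, ht.2 n hn, map_zero, mul_zero, zero_mul]
  have hconst : (φ.conj γ t).coeff 0 ≠ 0 := by
    rw [coeff_conj_apply, φ.coeff_zero]
    exact mul_ne_zero (mul_ne_zero γ⁻¹.ne_zero ((map_ne_zero _).2 h0)) (pow_ne_zero _ hγ0)
  obtain ⟨Λ, hcard, hΛ0, hΛadd, hΛprod, hΛgen⟩ := exists_finset_kernel hγ hvanish hconst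
  obtain ⟨l, hlΛ, hl⟩ := φ.exists_transcendental_of_relModularTrdeg_pos hφ hr0 ht.2 hγ
    (S := (Λ : Set Ω)) fun k hk => hΛgen k hk
  obtain ⟨S₀, hS₀⟩ := hK
  obtain ⟨F₁, L, ι, v, hF, hFL, hSL, hF₁, hlF₁, hfin, hle⟩ :=
    exists_valuations_of_transcendental hl
      (S := (Λ : Set Ω) ∪ {(γ : Ω)} ∪ (algebraMap K Ω) '' (S₀ : Set K))
      (((Finset.finite_toSet _).union (Set.finite_singleton _)).union
        ((Finset.finite_toSet _).image _)) (Or.inl (Or.inl hlΛ))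
  have hΛL : ∀ m ∈ Λ, m ∈ L := fun m hm => hSL (Or.inl (Or.inl hm))
  have hγL : (γ : Ω) ∈ L := hSL (Or.inl (Or.inr rfl))
  have hKL (x : K) : algebraMap K Ω x ∈ L := by
    let k : IntermediateField F K := (L.comap (algebraMap K Ω)).toIntermediateField fun c => by
      rw [Subfield.mem_comap, ← IsScalarTower.algebraMap_apply F K Ω]
      exact hFL (hF c)
    have hk : IntermediateField.adjoin F (S₀ : Set K) ≤ k :=
      IntermediateField.adjoin_le_iff.2 fun s hs => hSL (Or.inr ⟨s, hs, rfl⟩)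
    rw [hS₀] at hk
    exact hk (IntermediateField.mem_top (x := x))
  let e : K →+* L := (algebraMap K Ω).codRestrict L.toSubring hKL
  let g : L := ⟨(γ : Ω)⁻¹, inv_mem hγL⟩
  have hg0 : g ≠ 0 := fun h => inv_ne_zero hγ0 (congrArg Subtype.val h)
  let ψ : K →+ L := (AddMonoidHom.mulLeft g).comp e.toAddMonoidHom
  have hψ (x : K) : ψ x = g * e x := rfl
  let M : Finset L := Λ.subtype (· ∈ L)
  have hM (m : L) : m ∈ M ↔ (m : Ω) ∈ Λ := Finset.mem_subtype
  -- The elements without poles form the field `F₁`, so the inverse of such an element has no pole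
  -- either.
  have hone {x : L} (hx : ∀ j, v j x ≤ 1) (hx0 : x ≠ 0) (j : ι) : v j x = 1 := by
    have h1 : ∀ j, v j x⁻¹ ≤ 1 := (hle x⁻¹).2 (inv_mem ((hle x).1 hx))
    refine le_antisymm (hx j) ?_
    have h2 := h1 j
    rw [map_inv₀] at h2
    exact (inv_le_one₀ (zero_lt_iff.2 ((Valuation.ne_zero_iff _).2 hx0))).1 h2
  have hpole {x : L} (hx : (x : Ω) ∉ F₁) : ∃ j, 1 < v j x := by
    by_contra! h
    exact hx ((hle x).1 h)
  refine ⟨L, ι, v, M, ψ, ⟨?_, ?_, ?_, hfin, fun x hx0 hx => hone hx hx0, ?_⟩, ?_, ?_, ?_, ?_⟩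
  · exact (hM 0).2 hΛ0
  · exact fun a ha b hb => (hM _).2 (hΛadd _ ((hM a).1 ha) _ ((hM b).1 hb))
  · rw [Finset.card_subtype, Finset.filter_true_of_mem hΛL, hcard]
    have h2 : 2 ≤ Nat.card Fq := Finite.one_lt_card
    calc 3 ≤ 2 ^ 2 := by norm_num
      _ ≤ Nat.card Fq ^ 2 := Nat.pow_le_pow_left h2 2
      _ ≤ _ := Nat.pow_le_pow_right (by omega) hr
  · obtain ⟨j, hj⟩ := hpole (x := ⟨l, hΛL l hlΛ⟩) hlF₁
    exact ⟨j, _, (hM _).2 hlΛ, hj⟩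
  · exact fun x y hxy => e.injective (mul_left_cancel₀ hg0 hxy)
  · intro x
    apply Subtype.ext
    have h1 : ((ψ (evalHom (φ.toRingHom t) x) : L) : Ω) =
        evalHom (φ.conj γ t) ((ψ x : L) : Ω) := by
      change _ = evalHom (TwistedPoly.conj γ (baseChange Fq K Ω (φ.toRingHom t)))
        ((γ : Ω)⁻¹ * algebraMap K Ω x)
      rw [evalHom_conj, mul_inv_cancel_left₀ hγ0, evalHom_baseChange,
        Units.val_inv_eq_inv_val]
      rfl
    rw [h1, hΛprod]
    change _ = L.subtype (∏ m ∈ M, (ψ x - m))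
    rw [map_prod]
    refine (Finset.prod_subtype_of_mem (fun m => ((ψ x : L) : Ω) - m) hΛL).symm.trans ?_
    rfl
  · intro j c hc x
    obtain ⟨m, hm, hm1⟩ := isOfFinOrder_iff_pow_eq_one.1 (isOfFinOrder_of_finite (Units.mk0 c hc))
    have h1 : c ^ m = 1 := by simpa using congrArg Units.val hm1
    have h2 : v j (e (algebraMap Fq K c)) = 1 := by
      refine (pow_eq_one_iff_of_nonneg zero_le hm.ne').1 ?_
      rw [← map_pow, ← map_pow, ← map_pow, h1, map_one, map_one, map_one]
    rw [hψ, hψ, map_mul, map_mul, map_mul, map_mul, h2, one_mul]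
  -- `K` is not contained in `F₁`: otherwise `l`, algebraic over `K`, would be algebraic over `F₁`
  -- and so lie in it. Any `u` outside of `F₁` has a pole.
  · obtain ⟨u, hu⟩ : ∃ u : K, algebraMap K Ω u ∉ F₁ := by
      by_contra! h
      refine hlF₁ (hF₁ l ?_)
      refine (Algebra.IsAlgebraic.isAlgebraic (R := K) l).of_subset ?_
      rintro _ ⟨x, rfl⟩
      exact ⟨⟨_, h x⟩, rfl⟩
    obtain ⟨j, hj⟩ := hpole (x := e u) hu
    refine ⟨u, j, v j (e u), v j g, hj, (Valuation.ne_zero_iff _).2 hg0, fun n => ?_⟩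
    rw [hψ, map_mul, map_pow, map_pow]

end Escape

end DrinfeldModule

/-! ### Conclusion -/

open Polynomial WithZero

/-- A field which is finitely generated over a countable field is countable. -/
theorem IntermediateField.FG.countable {F K : Type*} [Field F] [Countable F] [Field K] [Algebra F K]
    (hK : (⊤ : IntermediateField F K).FG) : Countable K := by
  obtain ⟨S, hS⟩ := hK
  have h := IntermediateField.lift_cardinalMk_adjoin_le F (S : Set K)
  have hle : Cardinal.mk (IntermediateField.adjoin F (S : Set K)) ≤ Cardinal.aleph0 := by
    rw [← Cardinal.lift_le, Cardinal.lift_aleph0]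
    refine h.trans (sup_le (sup_le ?_ ?_) le_rfl)
    · simp
    · exact Cardinal.lift_le_aleph0.2 (Cardinal.mk_le_aleph0 (α := (S : Set K)))
  have : Countable (IntermediateField.adjoin F (S : Set K)) := Cardinal.mk_le_aleph0_iff.1 hle
  rw [hS] at this
  exact (IntermediateField.topEquiv (F := F) (E := K)).symm.injective.countable

/-- A nonzero algebraic element over a finite field is a root of unity. -/
theorem IsAlgebraic.exists_pow_eq_one {k E : Type*} [Field k] [Finite k] [Field E] [Algebra k E]
    {t : E} (ht : IsAlgebraic k t) (h0 : t ≠ 0) : ∃ m, m ≠ 0 ∧ t ^ m = 1 := by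
  have := IntermediateField.adjoin.finiteDimensional ht.isIntegral
  have : Finite (IntermediateField.adjoin k {t}) := Module.finite_of_finite k
  let g : IntermediateField.adjoin k {t} := ⟨t, IntermediateField.mem_adjoin_simple_self k t⟩
  have hg : g ≠ 0 := fun h => h0 (congrArg Subtype.val h)
  obtain ⟨m, hm, h1⟩ := isOfFinOrder_iff_pow_eq_one.1 (isOfFinOrder_of_finite (Units.mk0 g hg))
  exact ⟨m, hm.ne', congrArg (fun u : (IntermediateField.adjoin k {t})ˣ => ((u : _) : E)) h1⟩

/-- A geometric progression eventually has large logarithms, any finite number of consecutive ones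
being distinct and within a factor of two of each other. -/
theorem WithZero.exists_nat_log_mul_pow {a b R : ℤᵐ⁰} (ha : 1 < a) (hb : b ≠ 0) (hR : 1 ≤ R)
    (s : ℕ) : ∃ n : ℕ, (∀ j : Fin s, R < b * a ^ (n + j : ℕ)) ∧
      (Function.Injective fun j : Fin s => log (b * a ^ (n + j : ℕ))) ∧
      ∀ i j : Fin s, log (b * a ^ (n + i : ℕ)) < 2 * log (b * a ^ (n + j : ℕ)) := by
  have ha0 : a ≠ 0 := (zero_lt_one.trans ha).ne'
  have hR0 : R ≠ 0 := (zero_lt_one.trans_le hR).ne'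
  have hlog (m : ℕ) : log (b * a ^ m) = log b + m * log a := by
    rw [log_mul hb (pow_ne_zero _ ha0), log_pow, nsmul_eq_mul]
  have hℓ : 1 ≤ log a := by
    have := (log_lt_log one_ne_zero ha0).2 ha
    rw [log_one] at this
    omega
  have hρ : 0 ≤ log R := by
    have := (log_le_log one_ne_zero hR0).2 hR
    rwa [log_one] at this
  -- For this `n`, the quantity `log b + n * log a` exceeds both `log R` and `s * log a`, the most
  -- that the logarithm can grow over the next `s` terms.
  obtain ⟨n, hn⟩ : ∃ n : ℕ, (n : ℤ) = s + |log b| + log R + 1 :=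
    ⟨(s + |log b| + log R + 1).toNat, Int.toNat_of_nonneg (by positivity)⟩
  have hb1 := neg_abs_le (log b)
  have hs : (s : ℤ) * log a + |log b| + log R + 1 ≤ n * log a := by
    rw [hn]
    nlinarith [abs_nonneg (log b)]
  refine ⟨n, fun j => ?_, fun i j hij => ?_, fun i j => ?_⟩
  · rw [← log_lt_log hR0 (mul_ne_zero hb (pow_ne_zero _ ha0)), hlog]
    push_cast
    nlinarith [mul_nonneg (Int.natCast_nonneg j) (by omega : 0 ≤ log a),
      mul_nonneg (Int.natCast_nonneg s) (by omega : 0 ≤ log a)]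
  · dsimp only at hij
    rw [hlog, hlog, add_right_inj] at hij
    have := mul_right_cancel₀ (by omega) hij
    exact Fin.ext (by omega)
  · rw [hlog, hlog]
    push_cast
    have hi : ((i : ℕ) : ℤ) ≤ s := by exact_mod_cast i.2.le
    nlinarith [mul_nonneg (Int.natCast_nonneg j) (by omega : 0 ≤ log a),
      mul_le_mul_of_nonneg_right hi (by omega : 0 ≤ log a)]

theorem theoremT {Fq E K F : Type*}
    -- the finite field with `q` elements and a nonsingular projective curve over it
    [Field Fq] [Finite Fq] [Field E] [Algebra Fq E] (hE : IsCurveFunctionField Fq E)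
    -- a closed point of the curve
    (infty : ValuationSubring E) (hinfty : infty ≠ ⊤)
    -- an extension `K` of `Fq`
    [Field K] [Algebra Fq K]
    -- a countable field `F` over which `K` is finitely generated
    [Field F] [Countable F] [Algebra F K] (hK : (⊤ : IntermediateField F K).FG)
    (i : affineRing Fq infty →ₐ[Fq] K) (φ : DrinfeldModule i)
    (hφ : 0 < φ.relModularTrdeg F) :
    ∃ T N : Submodule (affineRing Fq infty) φ.Points,
      IsCompl T N ∧
      Finite T ∧ Module.IsTorsion (affineRing Fq infty) T ∧
      Module.Free (affineRing Fq infty) N ∧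
      Module.rank (affineRing Fq infty) N = Cardinal.aleph0 := by
  obtain ⟨t, r, h0, hr, hdeg⟩ := φ.exists_hasDegree
  -- An algebraic `t` would be a root of unity, which would make `φ_t` constant.
  have ht : Transcendental Fq (t : E) := by
    intro halg
    obtain ⟨m, hm, h1⟩ := halg.exists_pow_eq_one (fun h => h0 (by
      rw [show t = 0 from Subtype.ext h, map_zero]))
    refine hdeg.1 (TwistedPoly.coeff_eq_zero_of_pow_eq_one hm ?_ (by omega))
    rw [← map_pow, show t ^ m = 1 from Subtype.ext h1, map_one]
  obtain ⟨L, ι, v, Λ, ψ, hΛ, hψ, hprod, hconst, u, j₀, a, b, ha, hb, hu⟩ :=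
    φ.exists_isEscapeSystem hK hφ h0 hr hdeg
  let : Algebra Fq[X] (affineRing Fq infty) := (aeval t).toAlgebra
  let : Module Fq[X] φ.Points :=
    Module.compHom φ.Points (algebraMap Fq[X] (affineRing Fq infty))
  have : IsScalarTower Fq[X] (affineRing Fq infty) φ.Points :=
    IsScalarTower.of_algebraMap_smul fun _ _ => rfl
  let ψ' : φ.Points →+ L := ψ
  have hX (x : φ.Points) : ψ' ((X : Fq[X]) • x) = ∏ l ∈ Λ, (ψ' x - l) := by
    have h1 : (X : Fq[X]) • x = TwistedPoly.evalHom (φ.toRingHom t) x := by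
      change TwistedPoly.evalHom (φ.toRingHom (aeval t X)) x = _
      rw [aeval_X]
    exact (congrArg ψ' h1).trans (hprod x)
  have hC (j : ι) (c : Fq) (hc : c ≠ 0) (x : φ.Points) : v j (ψ' (C c • x)) = v j (ψ' x) := by
    have h1 : C c • x = algebraMap Fq K c * (show K from x) := by
      change TwistedPoly.evalHom (φ.toRingHom (aeval t (C c))) x = _
      rw [aeval_C, φ.toRingHom_algebraMap]
      exact TwistedPoly.evalHom_C _ _
    exact (congrArg (fun y => v j (ψ' y)) h1).trans (hconst j c hc x)
  have htame : Module.IsTame Fq[X] φ.Points := hΛ.isTame hψ hX hC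
  have hrank : Module.IsInfiniteRank Fq[X] φ.Points := by
    refine htame.isInfiniteRank fun s => ?_
    obtain ⟨n, h1, h2, h3⟩ :=
      WithZero.exists_nat_log_mul_pow ha hb (one_le_escapeRadius (v j₀) Λ) s
    have hval (j : ℕ) : v j₀ (ψ' (u ^ j : K)) = b * a ^ j := hu j
    refine ⟨fun j => (u ^ (n + j : ℕ) : K), IsEscapeSystem.linearIndependent_of_log hX (hC j₀)
      (by have := hΛ.three_le_card; omega) _ ?_ ?_ ?_⟩
    · simpa only [hval] using h1
    · simpa only [hval] using h2
    · simpa only [hval] using h3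
  have hfin : ∃ (n : ℕ) (a : Fin n → affineRing Fq infty), ∀ x : affineRing Fq infty,
      ∃ p : Fq[X], p ≠ 0 ∧ ∃ c : Fin n → Fq[X], p • x = ∑ j, c j • a j := by
    simp only [Algebra.smul_def]
    exact affineRing.exists_finite_family hE ht
  have hdvd (a : affineRing Fq infty) (ha : a ≠ 0) :
      ∃ p : Fq[X], p ≠ 0 ∧ a ∣ algebraMap Fq[X] (affineRing Fq infty) p :=
    affineRing.exists_dvd_aeval hE ht ha
  -- `A` inherits the Noetherian property from its action on `φ(K)`; only then is it known to be
  -- Dedekind.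
  have := htame.isNoetherianRing hrank hfin hdvd
  have := affineRing.isDedekindDomain hE ht
  have : Countable φ.Points := hK.countable
  obtain ⟨N, hN, ⟨e⟩⟩ := (htame.of_finite_rank hfin hdvd).exists_isCompl_torsion
    (hrank.of_finite_rank hfin hdvd)
  refine ⟨Submodule.torsion (affineRing Fq infty) φ.Points, N, hN, ?_,
    Submodule.torsion_isTorsion, Module.Free.of_equiv e.symm, ?_⟩
  · refine ((hΛ.finite_torsion (ψ := ψ') hψ hX hC).subset ?_).to_subtype
    intro x hx
    obtain ⟨⟨a, ha⟩, hax⟩ := (Submodule.mem_torsion_iff x).1 hx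
    obtain ⟨p, hp, c, hc⟩ := hdvd a (nonZeroDivisors.ne_zero ha)
    refine ⟨p, hp, ?_⟩
    rw [← algebraMap_smul (affineRing Fq infty) p x, hc, mul_comm, mul_smul]
    exact (congrArg (c • ·) hax).trans (smul_zero c)
  · have h := e.lift_rank_eq
    rw [rank_finsupp_self] at h
    simpa using h

end
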